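/- Let $(R,\mathfrak m)$ be a Noetherian local ring, let $I_1,I_2$ be $\mathfrak m$-primary ideals of $R$, let $k\ge 1$, and let $\mathbf x_k=x_1,\dots,x_k$ be a regular sequence in $R$ which is a superficial sequence for $I_2$ and $I_1$, with $(\mathbf x_k)\subseteq I_1\cap I_2$. Here an element $x\in I_2$ is *superficial for $I_2$ and $I_1$* if there is $r_0\ge 1$ with $xR\cap I_1^sI_2^r=xI_1^sI_2^{r-1}$ for all $r\ge r_0$ and $s\ge 0$, and $x_1,\dots,x_k$ is a *superficial sequence* if, for each $i$, the image of $x_i$ in $R/(x_1,\dots,x_{i-1})$ is superficial for the images of $I_2$ and $I_1$. For $n\ge 0$ let $D(n)$ be the complex whose term in degree $j$ is $(R/I_1I_2^{\,n-j})^{\binom kj}$ for $0\le j\le \min(k,n)$ and $0$ otherwise, with differentials induced by the Koszul complex $K_\bullet(\mathbf x_k;R)$, and put $$h_j(D,\mathbf x_k)(1,*)=\sum_{n\ge 0}\ell_R\big(H_j(D(n))\big).$$ Let $G_{I_1}(I_2)=R/I_1\oplus\bigoplus_{n\ge 1}I_1I_2^{\,n-1}/I_1I_2^{\,n}$ be the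 associated graded module of the filtration $R\supseteq I_1\supseteq I_1I_2\supseteq I_1I_2^2\supseteq\cdots$, regarded as a graded module over the Rees algebra $\bigoplus_n (I_1\cap I_2)^nt^n$ (if $I_2\subseteq I_1$ this action factors through $G(I_2)=\bigoplus_n I_2^n/I_2^{n+1}$). Let $x_i^\star$ be the class $x_it$ of $x_i$ in degree $1$, and let $\operatorname{depth}((\mathbf x_k)^\star,G_{I_1}(I_2))$ be the supremum of the lengths of $G_{I_1}(I_2)$-regular sequences contained in the ideal $(\mathbf x_k)^\star=(x_1^\star,\dots,x_k^\star)$. Then for every $i\ge 1$: the numbers $h_j(D,\mathbf x_k)(1,*)$, $j\ge i$, are finite and vanish for $j>k$; $$\sum_{j\ge i}(-1)^{j-i}h_j(D,\mathbf x_k)(1,*)\ \ge\ 0;$$ and equality holds if and only if $\operatorname{depth}((\mathbf x_k)^\star,G_{I_1}(I_2))\ge k-i+1$. -/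

import Mathlib

open CategoryTheory

namespace FiberCone

universe u

variable {R : Type u} [CommRing R]

/-! ### Superficial sequences -/

/-- `x ∈ I₂` is superficial for `I₂` and `I₁`: there is `r₀ ≥ 1` such that
`xR ∩ I₁ˢ I₂ʳ = x I₁ˢ I₂ʳ⁻¹` for all `r ≥ r₀` and all `s ≥ 0`. -/
def IsSuperficial (I₁ I₂ : Ideal R) (x : R) : Prop :=
  x ∈ I₂ ∧ ∃ r₀ : ℕ, 1 ≤ r₀ ∧ ∀ r s : ℕ, r₀ ≤ r →
    Ideal.span {x} ⊓ (I₁ ^ s * I₂ ^ r) = Ideal.span {x} * (I₁ ^ s * I₂ ^ (r - 1))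

/-- `x₁, …, x_k` is a superficial sequence for `I₂` and `I₁`: for each `i`, the image of `x_i` in
`R / (x₁, …, x_{i-1})` is superficial for the images of `I₂` and `I₁`. -/
def IsSuperficialSeq (I₁ I₂ : Ideal R) {k : ℕ} (x : Fin k → R) : Prop :=
  ∀ i : Fin k,
    let π := Ideal.Quotient.mk (Ideal.span (x '' {j | j < i}))
    IsSuperficial (I₁.map π) (I₂.map π) (π (x i))

/-! ### The truncated complex `D(x, (1, n))` -/

/-- The ideal whose quotient is the coefficient module in homological degree `j` of the truncated
complex: `I₁ I₂^(n-j)` for `j ≤ n`, and the unit ideal for `j > n` (the terms with `j > n`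
are cut off). -/
def dIdeal (I₁ I₂ : Ideal R) (n j : ℕ) : Ideal R :=
  if j ≤ n then I₁ * I₂ ^ (n - j) else ⊤

lemma mul_mem_dIdeal {I₁ I₂ : Ideal R} {y : R} (hy : y ∈ I₁ ⊓ I₂) (n j : ℕ) :
    dIdeal I₁ I₂ n (j + 1) ≤ Submodule.comap (LinearMap.mulLeft R y) (dIdeal I₁ I₂ n j) := by
  intro a ha
  simp only [Submodule.mem_comap, LinearMap.mulLeft_apply]
  unfold dIdeal at ha ⊢
  by_cases h : j + 1 ≤ n
  · rw [if_pos h] at ha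
    rw [if_pos (by omega), show n - j = (n - (j + 1)) + 1 by omega, pow_succ, ← mul_assoc,
      mul_comm y a]
    exact Ideal.mul_mem_mul ha hy.2
  · by_cases h' : j ≤ n
    · rw [if_pos h', show n - j = 0 by omega, pow_zero, mul_one]
      exact I₁.mul_mem_right a hy.1
    · rw [if_neg h']; trivial

/-- Multiplication by `y` as a map `R / I₁I₂^(n-j-1) → R / I₁I₂^(n-j)`. -/
def mulMap {I₁ I₂ : Ideal R} {y : R} (hy : y ∈ I₁ ⊓ I₂) (n j : ℕ) :
    (R ⧸ dIdeal I₁ I₂ n (j + 1)) →ₗ[R] (R ⧸ dIdeal I₁ I₂ n j) :=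
  Submodule.mapQ _ _ (LinearMap.mulLeft R y) (mul_mem_dIdeal hy n j)

/-- The `j`-element subsets of `{1, …, k}`, indexing the basis `e_s` of the degree `j` part of the
Koszul complex of `x₁, …, x_k`. -/
abbrev KIdx (k j : ℕ) : Type := {s : Finset (Fin k) // s.card = j}

/-- The term `(R / I₁I₂^(n-j))^(k choose j)` in homological degree `j` (zero if `j > n`). -/
abbrev DTerm (I₁ I₂ : Ideal R) (k n j : ℕ) : Type u :=
  KIdx k j → (R ⧸ dIdeal I₁ I₂ n j)

/-- `t ∪ {i}` for `i ∉ t`. -/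
def KIdx.insert {k j : ℕ} (t : KIdx k j) (i : {i : Fin k // i ∉ t.1}) : KIdx k (j + 1) :=
  ⟨Insert.insert i.1 t.1, by rw [Finset.card_insert_of_notMem i.2, t.2]⟩

/-- The Koszul sign of `i` relative to `t`: `(-1)` to the number of elements of `t` below `i`. -/
def kSign {k : ℕ} (t : Finset (Fin k)) (i : Fin k) : ℤ :=
  (-1) ^ (t.filter (· < i)).card

/-- The differential induced by the Koszul complex `K(x₁, …, x_k; R)`:
`e_s ↦ ∑_{i ∈ s} ± x_i e_{s \ {i}}`, i.e. the coordinate of `d f` at `t` is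
`∑_{i ∉ t} ± x_i f(t ∪ {i})`. -/
def dDiff {I₁ I₂ : Ideal R} {k : ℕ} {x : Fin k → R} (hx : ∀ i, x i ∈ I₁ ⊓ I₂) (n j : ℕ) :
    DTerm I₁ I₂ k n (j + 1) →ₗ[R] DTerm I₁ I₂ k n j :=
  LinearMap.pi fun t => ∑ i : {i : Fin k // i ∉ t.1},
    kSign t.1 i.1 • (mulMap (hx i.1) n j ∘ₗ LinearMap.proj (t.insert i))

lemma kSign_swap {k : ℕ} (t : Finset (Fin k)) {i l : Fin k} (hi : i ∉ t) (hl : l ∉ t)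
    (h : i ≠ l) :
    kSign t i * kSign (insert i t) l = -(kSign t l * kSign (insert l t) i) := by
  wlog hlt : i < l generalizing i l
  · rw [this hl hi h.symm (lt_of_le_of_ne (not_lt.1 hlt) h.symm), neg_neg]
  unfold kSign
  rw [Finset.filter_insert, if_pos hlt, Finset.filter_insert, if_neg (not_lt.2 hlt.le),
    Finset.card_insert_of_notMem (by simp [hi])]
  ring

lemma dDiff_comp {I₁ I₂ : Ideal R} {k : ℕ} {x : Fin k → R} (hx : ∀ i, x i ∈ I₁ ⊓ I₂) (n j : ℕ) :
    dDiff hx n j ∘ₗ dDiff hx n (j + 1) = 0 := by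
  refine LinearMap.ext fun f => ?_
  funext t
  simp only [dDiff, LinearMap.comp_apply, LinearMap.pi_apply, LinearMap.sum_apply,
    LinearMap.smul_apply, LinearMap.proj_apply, map_sum, map_zsmul, Finset.smul_sum,
    LinearMap.zero_apply, Pi.zero_apply]
  rw [Finset.sum_sigma']
  refine Finset.sum_involution
    (fun p _ => ⟨⟨p.2.1, fun h => p.2.2 (Finset.mem_insert_of_mem h)⟩,
      ⟨p.1.1, fun h => ?_⟩⟩) ?_ ?_ ?_ ?_
  · rcases Finset.mem_insert.1 h with h | h
    · exact p.2.2 (Finset.mem_insert.2 (Or.inl h.symm))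
    · exact p.1.2 h
  · rintro ⟨⟨i, hi⟩, ⟨l, hl⟩⟩ -
    have hil : i ≠ l := fun h => hl (Finset.mem_insert.2 (Or.inl h.symm))
    have hl' : l ∉ t.1 := fun h => hl (Finset.mem_insert_of_mem h)
    have e : KIdx.insert (KIdx.insert t ⟨i, hi⟩) ⟨l, hl⟩
        = KIdx.insert (KIdx.insert t ⟨l, hl'⟩) ⟨i, fun h => by
            rcases Finset.mem_insert.1 h with h | h
            · exact hil h
            · exact hi h⟩ := Subtype.ext (Finset.insert_comm _ _ _)
    dsimp only
    rw [← e, smul_smul, smul_smul]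
    obtain ⟨c, hc⟩ := Submodule.Quotient.mk_surjective _
      (f (KIdx.insert (KIdx.insert t ⟨i, hi⟩) ⟨l, hl⟩))
    rw [← hc]
    simp only [mulMap, Submodule.mapQ_apply, LinearMap.mulLeft_apply]
    have := kSign_swap t.1 hi hl' hil
    simp only [KIdx.insert]
    rw [this, mul_left_comm (x l), neg_smul, neg_add_cancel]
  · rintro ⟨⟨i, hi⟩, ⟨l, hl⟩⟩ - - h
    apply hl
    have := congrArg (fun p => p.1.1) h
    exact Finset.mem_insert.2 (Or.inl this)
  · intro p _
    exact Finset.mem_univ _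
  · rintro ⟨⟨i, hi⟩, ⟨l, hl⟩⟩ -
    rfl

/-- The truncated complex `D(x₁, …, x_k, (1, n))`, defined when `(x₁, …, x_k) ⊆ I₁ ∩ I₂`. -/
noncomputable def complexD {I₁ I₂ : Ideal R} {k : ℕ} {x : Fin k → R}
    (hx : ∀ i, x i ∈ I₁ ⊓ I₂) (n : ℕ) : ChainComplex (ModuleCat.{u} R) ℕ :=
  ChainComplex.of (fun j => ModuleCat.of R (DTerm I₁ I₂ k n j))
    (fun j => ModuleCat.ofHom (dDiff hx n j))
    (fun j => by rw [← ModuleCat.ofHom_comp, dDiff_comp]; rfl)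

/-- `h_j(D, x)(1, *) = ∑_{n ≥ 0} ℓ(H_j(D(x, (1, n))))`, with values in `ℕ ∪ {∞}`. -/
noncomputable def hD {I₁ I₂ : Ideal R} {k : ℕ} {x : Fin k → R}
    (hx : ∀ i, x i ∈ I₁ ⊓ I₂) (j : ℕ) : ℕ∞ :=
  ∑' n : ℕ, Module.length R ((complexD hx n).homology j)

/-! ### The associated graded module `G_{I₁}(I₂)` and its depth -/

/-- The filtration `R ⊇ I₁ ⊇ I₁I₂ ⊇ I₁I₂² ⊇ ⋯` of `R`; it satisfies
`(I₁ ∩ I₂) F_n ⊆ F_{n+1}`. If `I₂ ⊆ I₁`, then `I₁ ∩ I₂` is just `I₂`. -/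
def filtG (I₁ I₂ : Ideal R) : (I₁ ⊓ I₂).Filtration R where
  N n := match n with
    | 0 => ⊤
    | m + 1 => I₁ * I₂ ^ m
  mono n := match n with
    | 0 => le_top
    | m + 1 => Ideal.mul_mono_right (Ideal.pow_le_pow_right (Nat.le_succ m))
  smul_le n := match n with
    | 0 => by
      change (I₁ ⊓ I₂) * ⊤ ≤ I₁ * I₂ ^ 0
      rw [pow_zero, mul_one]
      exact Ideal.mul_le_left.trans inf_le_left
    | m + 1 => by
      change (I₁ ⊓ I₂) * (I₁ * I₂ ^ m) ≤ I₁ * I₂ ^ (m + 1)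
      rw [pow_succ, ← mul_assoc I₁, mul_comm]
      exact Ideal.mul_mono_right inf_le_right

/-- The shifted filtration `n ↦ F_{n+1}`. -/
def filtGShift (I₁ I₂ : Ideal R) : (I₁ ⊓ I₂).Filtration R where
  N n := (filtG I₁ I₂).N (n + 1)
  mono n := (filtG I₁ I₂).mono (n + 1)
  smul_le n := (filtG I₁ I₂).smul_le (n + 1)

/-- The subquotient `N / (N ∩ P)` of a module. -/
def SubQuot {A M : Type*} [CommRing A] [AddCommGroup M] [Module A M] (N P : Submodule A M) :=
  N ⧸ P.submoduleOf N

instance {A M : Type*} [CommRing A] [AddCommGroup M] [Module A M] (N P : Submodule A M) :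
    AddCommGroup (SubQuot N P) :=
  inferInstanceAs (AddCommGroup (N ⧸ P.submoduleOf N))

instance {A M : Type*} [CommRing A] [AddCommGroup M] [Module A M] (N P : Submodule A M) :
    Module A (SubQuot N P) :=
  inferInstanceAs (Module A (N ⧸ P.submoduleOf N))

/-- `G_{I₁}(I₂) = R/I₁ ⊕ I₁/I₁I₂ ⊕ I₁I₂/I₁I₂² ⊕ ⋯`, as the quotient `(⊕ F_n tⁿ) / (⊕ F_{n+1} tⁿ)`,
with its structure of graded module over the Rees algebra of `I₁ ∩ I₂`. If `I₂ ⊆ I₁`, this is the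
Rees algebra `R[I₂t]`, whose action on `G_{I₁}(I₂)` is the one through its quotient
`G(I₂) = ⊕ I₂ⁿ/I₂ⁿ⁺¹`. -/
abbrev GMod (I₁ I₂ : Ideal R) : Type u :=
  SubQuot (filtG I₁ I₂).submodule (filtGShift I₁ I₂).submodule

/-- The ideal `(x₁*, …, x_k*)`, where `x_i*` is the class of `x_i` in degree one (`x_i t` in the
Rees algebra); on `G_{I₁}(I₂)` it acts through `F_n/F_{n+1} → F_{n+1}/F_{n+2}`, `a ↦ x_i a`. -/
noncomputable def starIdeal {I₁ I₂ : Ideal R} {k : ℕ} {x : Fin k → R}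
    (hx : ∀ i, x i ∈ I₁ ⊓ I₂) : Ideal (reesAlgebra (I₁ ⊓ I₂)) :=
  Ideal.span (Set.range fun i =>
    ⟨Polynomial.monomial 1 (x i), reesAlgebra.monomial_mem.2 (by rw [pow_one]; exact hx i)⟩)

/-- `depth(J, M)`: the supremum of the lengths of `M`-regular sequences contained in `J`. -/
noncomputable def idealDepth {A : Type*} [CommRing A] (J : Ideal A)
    (M : Type*) [AddCommGroup M] [Module A M] : ℕ∞ :=
  ⨆ rs : {rs : List A // RingTheory.Sequence.IsRegular M rs ∧ ∀ r ∈ rs, r ∈ J},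
    (rs.1.length : ℕ∞)

end FiberCone

/-! Put F_0 = R and F_{n+1} = I₁I₂ⁿ, and let H_j(l, n) be the homology in degree j of the Koszul
complex of x_1, …, x_l with coefficients R/F_{n-j}, so that H_j(D(n)) = H_j(k, n+1) for j ≥ 1. The
complex of l+1 elements is the mapping cone of x_{l+1} on that of l elements. If κ(l, j, n) and c(l,
j, n) are the lengths of the kernel and cokernel of x_{l+1} : H_j(l, n) → H_j(l, n+1), the long
exact sequence gives ℓ(H_{j+1}(l+1, n+1)) = c(l, j+1, n) + κ(l, j, n).

Superficiality and regularity make x_{l+1} injective on H_0(l, n) for large n, whence H_j(l, n) = 0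
for j ≥ 1 and large n. As H_j(l, 0) = 0 too, c and κ have the same sum over n when j ≥ 1. Thus h_j =
K_j + K_{j-1} with K_j = ∑_n κ(k-1, j, n), and the alternating sum from i on telescopes to K_{i-1} ≥
0.

Equality says that x_k is injective on H_{i-1}(k-1, n) for all n. By `κ_zero_iff_regular` this means
that x_{l+1} is injective on all R/(F_n + (x_1, …, x_l)) for every l < k-i+1: a positive degree is
unwound through the long exact sequence, degree 0 needs the descent `injAt_of_injAt_succ`. By
`le_idealDepth_iff` these injectivities amount to depth ≥ k-i+1. They make the x_i* a regular
sequence; conversely, a first failure at l yields a nonzero element of G/(x_1*, …, x_l*)G killed by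
every x_i*, which vanishing of Ext forbids once the ideal contains a regular sequence longer than l.
-/

namespace FiberCone

universe u

/-! ### Regular sequences and vanishing of Ext -/

section ExtVanishing

open Abelian Limits RingTheory.Sequence Ideal

variable {A : Type u} [CommRing A]

/-- The first element `a` kills A/J, so it acts as zero on Ext(A/J, M); the vanishing for M/aM, one
degree lower, makes the same action injective. -/
lemma subsingleton_ext_of_isWeaklyRegular (J : Ideal A) (M : ModuleCat.{u} A) (rs : List A)
    (mem : ∀ r ∈ rs, r ∈ J) (reg : IsWeaklyRegular M rs) :
    ∀ i < rs.length, Subsingleton (Ext (ModuleCat.of A (A ⧸ J)) M i) := by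
  induction rs generalizing M with
  | nil => simp
  | cons a rs ih =>
    intro i hi
    simp only [isWeaklyRegular_cons_iff] at reg
    simp only [List.mem_cons, forall_eq_or_imp] at mem
    have ha : a ∈ Module.annihilator A (ModuleCat.of A (A ⧸ J)) := by
      change a ∈ Module.annihilator A (A ⧸ J)
      rw [Ideal.annihilator_quotient]; exact mem.1
    match i with
    | 0 =>
      have : Subsingleton ((ModuleCat.of A (A ⧸ J)) →ₗ[A] M) := by
        rw [subsingleton_iff_forall_eq 0]
        intro f
        refine LinearMap.ext fun v => reg.1.right_eq_zero_of_smul ?_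
        rw [← map_smul, Module.mem_annihilator.1 ha, map_zero]
      exact (Ext.addEquiv₀.trans ModuleCat.homAddEquiv).subsingleton
    | i + 1 =>
      let g := (AddCommGrpCat.ofHom ((Ext.mk₀ (M.smulShortComplex a).f).postcomp
        (ModuleCat.of A (A ⧸ J)) (add_zero (i + 1))))
      have mono_g : Mono g := by
        apply (Ext.covariant_sequence_exact₁' _ reg.1.smulShortComplex_shortExact i (i + 1)
          rfl).mono_g ((AddCommGrpCat.isZero_of_iff_subsingleton.mpr ?_).eq_zero_of_src _)
        exact ih (ModuleCat.of A (QuotSMulTop a M)) mem.2 reg.2 i (by simpa using hi)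
      have zero_g : g = 0 := by
        simp only [g, ModuleCat.smulShortComplex_f_eq_smul_id]
        exact Ext.postcomp_smul_id_eq_zero_of_mem_annihilator ha (i + 1)
      exact AddCommGrpCat.subsingleton_of_isZero (IsZero.of_mono_eq_zero _ zero_g)

/-- An element of M/(rs)M killed by J is a homomorphism from A/J. Passing from M to M/aM costs one
degree of vanishing, because Ext^i(A/J, M/aM) sits between Ext^i and Ext^{i+1} of M. The sequence
`rs` need not lie in J. -/
lemma mem_smul_top_of_subsingleton_ext (J : Ideal A) (M : ModuleCat.{u} A) (rs : List A)
    (reg : IsWeaklyRegular M rs)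
    (hext : ∀ i ≤ rs.length, Subsingleton (Ext (ModuleCat.of A (A ⧸ J)) M i))
    (z : M) (hz : ∀ a ∈ J, a • z ∈ (Ideal.ofList rs • ⊤ : Submodule A M)) :
    z ∈ (Ideal.ofList rs • ⊤ : Submodule A M) := by
  induction rs generalizing M with
  | nil =>
    simp only [Ideal.ofList_nil, Submodule.bot_smul, Submodule.mem_bot] at hz ⊢
    have := hext 0 le_rfl
    have : Subsingleton ((ModuleCat.of A (A ⧸ J)) →ₗ[A] M) :=
      (Ext.addEquiv₀.trans ModuleCat.homAddEquiv).symm.subsingleton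
    let f : (A ⧸ J) →ₗ[A] M := Submodule.liftQ J (LinearMap.toSpanSingleton A M z)
      fun a ha => by rw [LinearMap.mem_ker, LinearMap.toSpanSingleton_apply, hz a ha]
    have hf : f = 0 := Subsingleton.elim (α := ((ModuleCat.of A (A ⧸ J)) →ₗ[A] M)) f 0
    have : (1 : A) • z = 0 := congr($hf (Submodule.Quotient.mk 1))
    rwa [one_smul] at this
  | cons a rs ih =>
    rw [isWeaklyRegular_cons_iff] at reg
    have key : ∀ w : M, w ∈ (Ideal.ofList (a :: rs) • ⊤ : Submodule A M) ↔
        (Submodule.Quotient.mk w : QuotSMulTop a M) ∈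
          (Ideal.ofList rs • ⊤ : Submodule A (QuotSMulTop a M)) := by
      intro w
      have e : (Ideal.ofList rs • ⊤ : Submodule A (QuotSMulTop a M)) =
          (Ideal.ofList rs • ⊤ : Submodule A M).map (Submodule.mkQ _) := by
        rw [Submodule.map_smul'', Submodule.map_top, Submodule.range_mkQ]
      rw [e, Ideal.ofList_cons_smul, ← Submodule.comap_map_mkQ]
      rfl
    rw [key]
    refine ih (ModuleCat.of A (QuotSMulTop a M)) reg.2 (fun i hi => ?_)
      (Submodule.Quotient.mk z) fun b hb => (key (b • z)).1 (hz b hb)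
    have zero1 := AddCommGrpCat.isZero_of_iff_subsingleton.mpr
      (hext i (by simp only [List.length_cons]; omega))
    have zero2 := AddCommGrpCat.isZero_of_iff_subsingleton.mpr
      (hext (i + 1) (by simp only [List.length_cons]; omega))
    exact AddCommGrpCat.subsingleton_of_isZero <| ShortComplex.Exact.isZero_of_both_zeros
      ((Ext.covariant_sequence_exact₃' _ reg.1.smulShortComplex_shortExact) i (i + 1) rfl)
      (zero1.eq_zero_of_src _) (zero2.eq_zero_of_tgt _)

/-- If `rs` and `ys` are regular sequences in `J` with `rs` shorter than `ys`, then no nonzero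
element of `M / (rs) M` is killed by `J`. -/
lemma mem_smul_top_of_isWeaklyRegular {M : Type u} [AddCommGroup M] [Module A M] {J : Ideal A}
    {rs ys : List A} (hrs : IsWeaklyRegular M rs) (hys : IsWeaklyRegular M ys)
    (hJ : ∀ y ∈ ys, y ∈ J) (hlen : rs.length < ys.length)
    {z : M} (hz : ∀ a ∈ J, a • z ∈ (Ideal.ofList rs • ⊤ : Submodule A M)) :
    z ∈ (Ideal.ofList rs • ⊤ : Submodule A M) :=
  mem_smul_top_of_subsingleton_ext J (ModuleCat.of A M) rs hrs
    (fun i hi => subsingleton_ext_of_isWeaklyRegular J (ModuleCat.of A M) ys hJ hys i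
      (hi.trans_lt hlen)) z hz

end ExtVanishing

/-! ### Numerical consequences of the long exact sequences -/

section Numerics

variable {k : ℕ} {h c κ : ℕ → ℕ → ℕ → ℕ}

/-- The numerical relations between the lengths `h` of the homology modules of the truncated Koszul
complexes of `x₁, …, x_l`, and the lengths `κ`, `c` of the kernels and cokernels of multiplication
by `x_{l+1}` on them. -/
structure LengthRelations (k : ℕ) (h c κ : ℕ → ℕ → ℕ → ℕ) : Prop where
  h_zero : ∀ l j, h l j 0 = 0
  h_empty : ∀ j n, h 0 (j + 1) n = 0
  h_succ : ∀ l j n, h (l + 1) (j + 1) (n + 1) = c l (j + 1) n + κ l j n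
  balance : ∀ l j n, h l j n + c l j n = κ l j n + h l j (n + 1)
  κ_le : ∀ l j n, κ l j n ≤ h l j n
  eventually : ∀ l < k, ∃ N, ∀ n ≥ N, κ l 0 n = 0
  descent : ∀ l, l + 1 < k → (∀ n, κ (l + 1) 0 n = 0) → ∀ n, κ l 0 n = 0

namespace LengthRelations

lemma c_le (H : LengthRelations k h c κ) (l j n : ℕ) : c l j n ≤ h l j (n + 1) := by
  have := H.balance l j n
  have := H.κ_le l j n
  omega

lemma h_eq_zero_of_lt (H : LengthRelations k h c κ) {l j : ℕ} (hlj : l < j) (n : ℕ) :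
    h l j n = 0 := by
  induction l generalizing j n with
  | zero =>
    obtain ⟨j, rfl⟩ := Nat.exists_eq_succ_of_ne_zero hlj.ne'
    exact H.h_empty j n
  | succ l ih =>
    obtain ⟨j, rfl⟩ := Nat.exists_eq_succ_of_ne_zero (Nat.ne_zero_of_lt hlj)
    cases n with
    | zero => exact H.h_zero _ _
    | succ n =>
      have h1 := H.c_le l (j + 1) n
      have h2 := H.κ_le l j n
      rw [ih (by omega)] at h1 h2
      rw [H.h_succ]; omega

/-- Both summands of `h_succ` die for large n by induction on l: `c` is bounded by `h`, and so is
`κ`, except in degree 0, where `eventually` is the input. -/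
lemma h_eventually (H : LengthRelations k h c κ) {l : ℕ} (hl : l ≤ k) (j : ℕ) :
    ∃ N, ∀ n ≥ N, h l (j + 1) n = 0 := by
  induction l generalizing j with
  | zero => exact ⟨0, fun n _ => H.h_empty j n⟩
  | succ l ih =>
    obtain ⟨N₁, h₁⟩ := ih (by omega) j
    have h₂ : ∃ N, ∀ n ≥ N, κ l j n = 0 := by
      cases j with
      | zero => exact H.eventually l hl
      | succ j =>
        obtain ⟨N, hN⟩ := ih (by omega) j
        exact ⟨N, fun n hn => Nat.eq_zero_of_le_zero ((H.κ_le l (j + 1) n).trans (hN n hn).le)⟩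
    obtain ⟨N₂, h₂⟩ := h₂
    refine ⟨N₁ + N₂ + 1, fun n hn => ?_⟩
    obtain ⟨n, rfl⟩ := Nat.exists_eq_succ_of_ne_zero (by omega : n ≠ 0)
    have := H.c_le l (j + 1) n
    rw [h₁ _ (by omega)] at this
    have := h₂ n (by omega)
    have := H.h_succ l j n
    simp only [Nat.succ_eq_add_one]; omega

lemma κ_eventually (H : LengthRelations k h c κ) {l : ℕ} (hl : l < k) (j : ℕ) :
    ∃ N, ∀ n ≥ N, κ l j n = 0 := by
  cases j with
  | zero => exact H.eventually l hl
  | succ j =>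
    obtain ⟨N, hN⟩ := H.h_eventually hl.le j
    exact ⟨N, fun n hn => Nat.eq_zero_of_le_zero ((H.κ_le l (j + 1) n).trans (hN n hn).le)⟩

/-- Surjectivity at every step propagates the vanishing at n = 0 upwards. -/
lemma c_zero_iff (H : LengthRelations k h c κ) (l j : ℕ) :
    (∀ n, c l j n = 0) ↔ ∀ n, h l j n = 0 := by
  refine ⟨fun hc n => ?_, fun hh n => Nat.eq_zero_of_le_zero ((H.c_le l j n).trans (hh _).le)⟩
  induction n with
  | zero => exact H.h_zero _ _
  | succ n ih =>
    have := H.balance l j n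
    have := hc n
    omega

/-- Injectivity makes `h` nondecreasing in n, and in positive homological degree `h` is eventually
zero. -/
lemma κ_zero_iff (H : LengthRelations k h c κ) {l : ℕ} (hl : l ≤ k) (j : ℕ) :
    (∀ n, κ l (j + 1) n = 0) ↔ ∀ n, h l (j + 1) n = 0 := by
  refine ⟨fun hκ n => ?_, fun hh n => Nat.eq_zero_of_le_zero ((H.κ_le l _ n).trans (hh _).le)⟩
  obtain ⟨N, hN⟩ := H.h_eventually hl j
  have : ∀ m, h l (j + 1) n ≤ h l (j + 1) (n + m) := by
    intro m
    induction m with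
    | zero => exact le_rfl
    | succ m ih =>
      have := H.balance l (j + 1) (n + m)
      have := hκ (n + m)
      rw [← add_assoc]; omega
  exact Nat.eq_zero_of_le_zero ((this N).trans (hN _ (by omega)).le)

/-- Homology in degree j+1 for l+1 elements vanishes exactly when x_{l+1} is surjective in degree
j+1 and injective in degree j for l elements. The former means vanishing in degree j+1; for j > 0
the latter means vanishing in degree j, which is the stronger condition. For j = 0 it adds the new
condition on `κ l 0`. -/
lemma h_zero_iff (H : LengthRelations k h c κ) {l : ℕ} (hl : l ≤ k) (j : ℕ) :
    (∀ n, h l (j + 1) n = 0) ↔ ∀ l' < l - j, ∀ n, κ l' 0 n = 0 := by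
  induction l generalizing j with
  | zero => simp [H.h_empty]
  | succ l ih =>
    have hs : (∀ n, h (l + 1) (j + 1) n = 0) ↔
        (∀ n, h l (j + 1) n = 0) ∧ ∀ n, κ l j n = 0 := by
      rw [← H.c_zero_iff l (j + 1)]
      refine ⟨fun hh => ?_, fun ⟨h1, h2⟩ n => ?_⟩
      · refine ⟨fun n => ?_, fun n => ?_⟩ <;>
        · have := H.h_succ l j n
          rw [hh] at this
          omega
      · cases n with
        | zero => exact H.h_zero _ _
        | succ n => rw [H.h_succ, h1, h2]
    rw [hs, ih (by omega)]
    cases j with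
    | zero =>
      refine ⟨fun ⟨h1, h2⟩ l' hl' => ?_, fun hh => ⟨fun l' hl' => hh l' (by omega), hh l (by omega)⟩⟩
      rcases (by omega : l' < l ∨ l' = l) with h' | rfl
      · exact h1 l' (by omega)
      · exact h2
    | succ j =>
      rw [H.κ_zero_iff (by omega), ih (by omega)]
      exact ⟨fun ⟨_, h2⟩ l' hl' => h2 l' (by omega),
        fun hh => ⟨fun l' hl' => hh l' (by omega), fun l' hl' => hh l' (by omega)⟩⟩

/-- In positive degree injectivity is vanishing, covered by `h_zero_iff`. In degree 0 it says
nothing formally about smaller l, and `descent` supplies that. -/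
lemma κ_zero_iff_regular (H : LengthRelations k h c κ) {l : ℕ} (hl : l < k) (j : ℕ) :
    (∀ n, κ l j n = 0) ↔ ∀ l' < l + 1 - j, ∀ n, κ l' 0 n = 0 := by
  cases j with
  | succ j =>
    rw [H.κ_zero_iff hl.le, H.h_zero_iff hl.le, show l + 1 - (j + 1) = l - j by omega]
  | zero =>
    refine ⟨fun hκ => ?_, fun hh => hh l (by omega)⟩
    induction l with
    | zero => intro l' hl'; obtain rfl : l' = 0 := by omega
              exact hκ
    | succ l ih =>
      intro l' hl'
      rcases (by omega : l' < l + 1 - 0 ∨ l' = l + 1) with h' | rfl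
      · exact ih (by omega) (H.descent l hl hκ) l' h'
      · exact hκ

/-- Summing `balance` in degree j+1 over n < N telescopes, and both end terms of `h` vanish; so `c`
may be replaced by `κ` in the sum of `h_succ`. -/
lemma exists_sum_h (H : LengthRelations k h c κ) {l : ℕ} (hl : l < k) (j : ℕ) :
    ∃ N, (∀ n ≥ N, h (l + 1) (j + 1) (n + 1) = 0) ∧
      (∀ n ≥ N, κ l j n = 0) ∧ (∀ n ≥ N, κ l (j + 1) n = 0) ∧
      ∑ n ∈ Finset.range N, h (l + 1) (j + 1) (n + 1) =
        ∑ n ∈ Finset.range N, κ l (j + 1) n + ∑ n ∈ Finset.range N, κ l j n := by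
  obtain ⟨N₁, h₁⟩ := H.h_eventually hl.le j
  obtain ⟨N₂, h₂⟩ := H.κ_eventually hl j
  obtain ⟨N₃, h₃⟩ := H.κ_eventually hl (j + 1)
  obtain ⟨N₄, h₄⟩ := H.h_eventually (Nat.succ_le_of_lt hl) j
  refine ⟨N₁ + N₂ + N₃ + N₄, fun n hn => h₄ _ (by omega), fun n hn => h₂ _ (by omega),
    fun n hn => h₃ _ (by omega), ?_⟩
  set N := N₁ + N₂ + N₃ + N₄
  simp only [H.h_succ, Finset.sum_add_distrib, Nat.add_right_cancel_iff]
  have hb : ∑ n ∈ Finset.range N, (h l (j + 1) n + c l (j + 1) n) =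
      ∑ n ∈ Finset.range N, (κ l (j + 1) n + h l (j + 1) (n + 1)) :=
    Finset.sum_congr rfl fun n _ => H.balance _ _ _
  have ht := (Finset.sum_range_succ (h l (j + 1)) N).symm.trans (Finset.sum_range_succ' _ N)
  rw [h₁ N (by omega), H.h_zero] at ht
  simp only [Finset.sum_add_distrib] at hb
  omega

lemma tsum_eq_sum_range {f : ℕ → ℕ} {N : ℕ} (hf : ∀ n ≥ N, f n = 0) :
    ∑' n, f n = ∑ n ∈ Finset.range N, f n :=
  tsum_eq_sum fun n hn => hf n (by simpa using hn)

lemma tsum_coe_eq {f : ℕ → ℕ} {N : ℕ} (hf : ∀ n ≥ N, f n = 0) :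
    ∑' n, (f n : ℕ∞) = ((∑' n, f n : ℕ) : ℕ∞) := by
  rw [tsum_eq_sum_range hf, Nat.cast_sum]
  exact tsum_eq_sum fun n hn => by rw [hf n (by simpa using hn), Nat.cast_zero]

lemma tsum_h (H : LengthRelations k h c κ) {l : ℕ} (hl : l < k) (j : ℕ) :
    ∑' n, (h (l + 1) (j + 1) (n + 1) : ℕ∞) =
      ((∑' n, κ l (j + 1) n + ∑' n, κ l j n : ℕ) : ℕ∞) := by
  obtain ⟨N, h₁, h₂, h₃, h₄⟩ := H.exists_sum_h hl j
  rw [tsum_coe_eq h₁, tsum_eq_sum_range h₁, tsum_eq_sum_range h₂, tsum_eq_sum_range h₃, h₄]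

lemma tsum_κ_eq_zero_iff (H : LengthRelations k h c κ) {l : ℕ} (hl : l < k) (j : ℕ) :
    ∑' n, κ l j n = 0 ↔ ∀ n, κ l j n = 0 := by
  obtain ⟨N, hN⟩ := H.κ_eventually hl j
  rw [tsum_eq_sum_range hN, Finset.sum_eq_zero_iff]
  refine ⟨fun hh n => ?_, fun hh n _ => hh n⟩
  by_cases hn : n < N
  · exact hh n (by simpa using hn)
  · exact hN n (by omega)

end LengthRelations

lemma alternating_sum_telescope (K : ℕ → ℤ) {i k : ℕ} (hik : i ≤ k) (hK : K (k + 1) = 0) :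
    ∑ j ∈ Finset.Icc (i + 1) (k + 1), (-1 : ℤ) ^ (j - (i + 1)) * (K j + K (j - 1)) = K i := by
  obtain ⟨m, rfl⟩ := Nat.exists_eq_add_of_le hik
  clear hik
  induction m generalizing i with
  | zero => simp at hK ⊢; simp [hK]
  | succ m ih =>
    rw [← Finset.insert_Icc_succ_left_eq_Icc (by omega), Finset.sum_insert (by simp)]
    have := ih (i := i + 1) (by rw [← hK]; congr 1; omega)
    rw [show i + (m + 1) = i + 1 + m by omega]
    have e : ∑ j ∈ Finset.Icc (i + 1 + 1) (i + 1 + m + 1), (-1 : ℤ) ^ (j - (i + 1)) *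
        (K j + K (j - 1)) = - K (i + 1) := by
      rw [← this, ← Finset.sum_neg_distrib]
      refine Finset.sum_congr rfl fun j hj => ?_
      rw [Finset.mem_Icc] at hj
      rw [show j - (i + 1) = j - (i + 1 + 1) + 1 by omega, pow_succ]
      ring
    simp only [Nat.succ_eq_succ, Nat.succ_eq_add_one] at e ⊢
    rw [e]; simp

end Numerics

variable {R : Type u} [CommRing R]

/-! ### Filtrations modulo initial segments of a sequence -/

section Filtrations

/-- The ideal generated by the first `l` terms of a sequence. -/
def initIdeal (X : ℕ → R) (l : ℕ) : Ideal R := Ideal.span (X '' Set.Iio l)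

lemma initIdeal_zero (X : ℕ → R) : initIdeal X 0 = ⊥ := by
  simp [initIdeal]

lemma initIdeal_succ (X : ℕ → R) (l : ℕ) :
    initIdeal X (l + 1) = initIdeal X l ⊔ Ideal.span {X l} := by
  rw [initIdeal, initIdeal, ← Ideal.span_union]
  congr 1
  ext r
  simp only [Set.mem_image, Set.mem_Iio, Set.mem_union, Set.mem_singleton_iff]
  refine ⟨fun ⟨j, hj, hr⟩ => ?_, ?_⟩
  · rcases (by omega : j < l ∨ j = l) with h | rfl
    · exact Or.inl ⟨j, h, hr⟩
    · exact Or.inr hr.symm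
  · rintro (⟨j, hj, hr⟩ | rfl)
    · exact ⟨j, by omega, hr⟩
    · exact ⟨l, by omega, rfl⟩

lemma mem_initIdeal_succ {X : ℕ → R} {l : ℕ} {r : R} :
    r ∈ initIdeal X (l + 1) ↔ ∃ s ∈ initIdeal X l, ∃ b, s + X l * b = r := by
  simp [initIdeal_succ, Submodule.mem_sup, Ideal.mem_span_singleton']
  simp only [mul_comm]

lemma mem_initIdeal_of_lt (X : ℕ → R) {i l : ℕ} (h : i < l) : X i ∈ initIdeal X l :=
  Ideal.subset_span ⟨i, h, rfl⟩

/-- `x_{l+1}` is injective on `⨁ R / (F_n + (x₁, …, x_l))` in degree `n`. -/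
def InjAt (F : ℕ → Ideal R) (X : ℕ → R) (l n : ℕ) : Prop :=
  ∀ r, X l * r ∈ F (n + 1) ⊔ initIdeal X l → r ∈ F n ⊔ initIdeal X l

variable {F : ℕ → Ideal R} {X : ℕ → R}

lemma mul_mem_sup_initIdeal {y : R} (hmul : ∀ n, ∀ r ∈ F n, y * r ∈ F (n + 1)) (l : ℕ) {n : ℕ}
    {r : R} (hr : r ∈ F n ⊔ initIdeal X l) : y * r ∈ F (n + 1) ⊔ initIdeal X l := by
  obtain ⟨a, ha, b, hb, rfl⟩ := Submodule.mem_sup.1 hr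
  rw [mul_add]
  exact Submodule.add_mem_sup (hmul n a ha) (Ideal.mul_mem_left _ _ hb)

lemma pow_mul_mem_sup_initIdeal {y : R} (hmul : ∀ n, ∀ r ∈ F n, y * r ∈ F (n + 1)) (l p : ℕ) {n : ℕ}
    {r : R} (hr : r ∈ F n ⊔ initIdeal X l) : y ^ p * r ∈ F (n + p) ⊔ initIdeal X l := by
  induction p with
  | zero => simpa using hr
  | succ p ih =>
    rw [pow_succ', mul_assoc]
    exact mul_mem_sup_initIdeal hmul l ih

/-- Descent of regularity along a filter-regular element: if `x_{l+2}` is regular on the associated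
graded module modulo `x_{l+1}`, and `x_{l+1}` is injective in large degrees, then `x_{l+1}`
is injective in all degrees. -/
lemma injAt_of_injAt_succ (hF0 : F 0 = ⊤) (hmul : ∀ i n, ∀ r ∈ F n, X i * r ∈ F (n + 1)) {l : ℕ}
    (hev : ∃ N, ∀ n ≥ N, InjAt F X l n) (h : ∀ n, InjAt F X (l + 1) n) (n : ℕ) :
    InjAt F X l n := by
  obtain ⟨N, hN⟩ := hev
  have hdown : ∀ p n r, N ≤ n → X l ^ p * r ∈ F (n + p) ⊔ initIdeal X l →
      r ∈ F n ⊔ initIdeal X l := by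
    intro p
    induction p with
    | zero => intro n r _ hr; simpa using hr
    | succ p ih =>
      intro n r hn hr
      refine ih n r hn (hN _ (by omega) _ ?_)
      rw [← mul_assoc, ← pow_succ']
      exact hr
  have hdown' : ∀ p n r, X (l + 1) ^ p * r ∈ F (n + p) ⊔ initIdeal X (l + 1) →
      r ∈ F n ⊔ initIdeal X (l + 1) := by
    intro p
    induction p with
    | zero => intro n r hr; simpa using hr
    | succ p ih =>
      intro n r hr
      refine ih n r (h _ _ ?_)
      rw [← mul_assoc, ← pow_succ']
      exact hr
  have hle : ∀ n, F n ⊔ initIdeal X l ≤ F n ⊔ initIdeal X (l + 1) := fun n =>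
    sup_le_sup_left (by rw [initIdeal_succ]; exact le_sup_left) _
  -- The exponent p stays free: each step of the induction trades one unit of n for one more factor
  -- x_{l+1}.
  have key : ∀ n p r, X l ^ p * r ∈ F (n + p) ⊔ initIdeal X l → r ∈ F n ⊔ initIdeal X l := by
    intro n
    induction n with
    | zero => intro p r _; rw [hF0, top_sup_eq]; trivial
    | succ n ih =>
      intro p r hr
      -- Multiplication by x_{l+2}^N moves into degrees ≥ N, where x_{l+1}^p can be cancelled;
      -- afterwards x_{l+2}^N is cancelled modulo x_{l+1}.
      have h1 : X (l + 1) ^ N * r ∈ F (n + 1 + N) ⊔ initIdeal X l := by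
        refine hdown p _ _ (by omega) ?_
        rw [mul_left_comm, add_right_comm]
        exact pow_mul_mem_sup_initIdeal (hmul _) l N hr
      have h2 := hdown' N _ r (hle _ h1)
      obtain ⟨e, he, a, ha, rfl⟩ := Submodule.mem_sup.1 h2
      obtain ⟨s, hs, b, rfl⟩ := mem_initIdeal_succ.1 ha
      have hes : e + s ∈ F (n + 1) ⊔ initIdeal X l := Submodule.add_mem_sup he hs
      rw [← add_assoc] at hr ⊢
      refine add_mem hes (mul_mem_sup_initIdeal (hmul l) l (ih (p + 1) b ?_))
      have := sub_mem hr (pow_mul_mem_sup_initIdeal (hmul l) l p hes)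
      rw [show n + (p + 1) = n + 1 + p by omega]
      convert this using 1
      ring
  intro r hr
  exact key n 1 r (by simpa using hr)

/-- The Valabrega–Valla condition. Injectivity splits the last coefficient into a part in F_n and a
part in (x_1, …, x_l); the second part is absorbed by the first l terms, where induction applies. -/
lemma inf_initIdeal_le (hmul : ∀ i n, ∀ r ∈ F n, X i * r ∈ F (n + 1)) {l : ℕ}
    (h : ∀ l' < l, ∀ n, InjAt F X l' n) (n : ℕ) :
    F (n + 1) ⊓ initIdeal X l ≤ initIdeal X l * F n := by
  induction l with
  | zero => simp [initIdeal_zero]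
  | succ l ih =>
    rintro b ⟨hb, hb'⟩
    obtain ⟨s, hs, r, rfl⟩ := mem_initIdeal_succ.1 hb'
    have hr : X l * r ∈ F (n + 1) ⊔ initIdeal X l := by
      rw [show X l * r = (s + X l * r) - s by ring]
      exact sub_mem (Submodule.mem_sup_left hb) (Submodule.mem_sup_right hs)
    obtain ⟨r', hr', s', hs', rfl⟩ := Submodule.mem_sup.1 (h l (by omega) n r hr)
    have hmem : s + X l * s' ∈ F (n + 1) ⊓ initIdeal X l := by
      refine ⟨?_, add_mem hs (Ideal.mul_mem_left _ _ hs')⟩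
      have := sub_mem hb (hmul l n r' hr')
      rwa [show s + X l * (r' + s') - X l * r' = s + X l * s' by ring] at this
    have h1 := ih (fun l' hl' => h l' (by omega)) hmem
    have h2 : initIdeal X l ≤ initIdeal X (l + 1) := by rw [initIdeal_succ]; exact le_sup_left
    rw [show s + X l * (r' + s') = (s + X l * s') + X l * r' by ring]
    exact add_mem (Ideal.mul_mono_left h2 h1)
      (Ideal.mul_mem_mul (mem_initIdeal_of_lt X (by omega)) hr')

/-- If `x_{l+1}` is not injective on `⨁ R / (F_n + (x₁, …, x_l))` but is so in large degrees, then
there is a nonzero element of `⨁ F_n / (F_{n+1} + (x₁, …, x_l) ∩ F_n)` killed by all `x_i`. -/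
lemma exists_socle_of_not_injAt (hF0 : F 0 = ⊤) (hanti : ∀ n, F (n + 1) ≤ F n)
    (hmul : ∀ i n, ∀ r ∈ F n, X i * r ∈ F (n + 1)) {l : ℕ}
    (hev : ∃ N, ∀ n ≥ N, InjAt F X l n) (h : ¬ ∀ n, InjAt F X l n) :
    ∃ n, ∃ r ∈ F n, r ∉ F (n + 1) ⊔ initIdeal X l ∧
      ∀ i, X i * r ∈ F (n + 2) ⊔ initIdeal X l := by
  classical
  obtain ⟨N, hN⟩ := hev
  push Not at h
  obtain ⟨m, hm⟩ := h
  -- The last degree n in which injectivity fails is used.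
  have hmax := Nat.findGreatest_spec (P := fun n => ¬ InjAt F X l n) (n := N) (m := m)
    (by by_contra hlt; exact hm (hN m (by omega))) hm
  set n := Nat.findGreatest (fun n => ¬ InjAt F X l n) N with hn
  have hgt : ∀ n' > n, InjAt F X l n' := by
    intro n' hn'
    by_cases h' : n' ≤ N
    · by_contra hc
      exact Nat.findGreatest_is_greatest hn' h' hc
    · exact hN n' (by omega)
  simp only [InjAt] at hmax
  push Not at hmax
  obtain ⟨r, hr, hr'⟩ := hmax
  -- x_{l+1}(x_i r) lies in degree n+2 modulo the initial ideal, and injectivity does hold in degree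
  -- n+1.
  have hkill : ∀ i, X i * r ∈ F (n + 1) ⊔ initIdeal X l := by
    intro i
    refine hgt (n + 1) (by omega) _ ?_
    rw [mul_left_comm]
    exact mul_mem_sup_initIdeal (hmul i) l hr
  -- The element r need not lie in F_n, so it is placed at its own order p modulo the initial ideal.
  -- Since p < n, membership of x_i r in F_{n+1} is enough for F_{p+2}.
  have hex : ∃ p, r ∉ F p ⊔ initIdeal X l := ⟨n, hr'⟩
  have hp := Nat.find_spec hex
  have hpn : Nat.find hex ≤ n := Nat.find_min' hex hr'
  obtain ⟨p, hpe⟩ : ∃ p, Nat.find hex = p + 1 := by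
    refine Nat.exists_eq_succ_of_ne_zero fun h0 => ?_
    rw [h0, hF0, top_sup_eq] at hp
    exact hp trivial
  have hlow : r ∈ F p ⊔ initIdeal X l := by
    by_contra hc
    exact Nat.find_min hex (by omega) hc
  rw [hpe] at hp hpn
  obtain ⟨a, ha, s, hs, rfl⟩ := Submodule.mem_sup.1 hlow
  refine ⟨p, a, ha, fun hc => hp (add_mem hc (Submodule.mem_sup_right hs)), fun i => ?_⟩
  have h1 := hkill i
  have h2 : F (n + 1) ⊔ initIdeal X l ≤ F (p + 2) ⊔ initIdeal X l :=
    sup_le_sup_right (antitone_nat_of_succ_le hanti (by omega)) _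
  have h3 := sub_mem (h2 h1) (Submodule.mem_sup_right
    (Ideal.mul_mem_left _ (X i) hs) : X i * s ∈ F (p + 2) ⊔ initIdeal X l)
  convert h3 using 1
  ring

end Filtrations

/-! ### Superficial sequences give injectivity in high degrees -/

section Superficial

/-- The extension of a finite sequence by zero. -/
def extendSeq {k : ℕ} (x : Fin k → R) (n : ℕ) : R := if h : n < k then x ⟨n, h⟩ else 0

lemma extendSeq_of_lt {k : ℕ} (x : Fin k → R) (i : Fin k) : extendSeq x i = x i := by
  simp [extendSeq]

lemma extendSeq_mem {k : ℕ} {x : Fin k → R} {I : Ideal R} (hx : ∀ i, x i ∈ I) (n : ℕ) :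
    extendSeq x n ∈ I := by
  unfold extendSeq
  split_ifs
  · exact hx _
  · exact zero_mem _

lemma initIdeal_extendSeq {k : ℕ} (x : Fin k → R) (i : Fin k) :
    initIdeal (extendSeq x) i = Ideal.span (x '' {j | j < i}) := by
  unfold initIdeal
  congr 1
  ext r
  refine ⟨fun ⟨j, hj, hr⟩ => ?_, fun ⟨j, hj, hr⟩ => ⟨j, hj, by rwa [extendSeq_of_lt]⟩⟩
  have hj' : j < i := hj
  have hjk : j < k := hj'.trans i.2
  exact ⟨⟨j, hjk⟩, hj', by rw [← hr, ← extendSeq_of_lt x ⟨j, hjk⟩]⟩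

lemma ofList_take_ofFn {k : ℕ} (x : Fin k → R) (i : Fin k) :
    Ideal.ofList ((List.ofFn x).take i) = initIdeal (extendSeq x) i := by
  rw [initIdeal_extendSeq]
  unfold Ideal.ofList
  congr 1
  ext r
  simp only [Set.mem_ofPred_eq, List.mem_take_iff_getElem, List.getElem_ofFn, List.length_ofFn,
    Set.mem_image]
  refine ⟨fun ⟨j, hj, hr⟩ => ⟨⟨j, by omega⟩, Fin.lt_def.2 (by simp; omega), hr⟩,
    fun ⟨j, hj, hr⟩ => ⟨j, ?_, hr⟩⟩
  have : (j : ℕ) < i := hj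
  omega

lemma mem_initIdeal_of_mul_mem {k : ℕ} {x : Fin k → R}
    (hreg : RingTheory.Sequence.IsWeaklyRegular R (List.ofFn x)) (i : Fin k) {r : R}
    (hr : x i * r ∈ initIdeal (extendSeq x) i) : r ∈ initIdeal (extendSeq x) i := by
  have h := hreg.regular_mod_prev i (by simp)
  rw [List.getElem_ofFn, ofList_take_ofFn, isSMulRegular_quotient_iff_mem_of_smul_mem] at h
  simpa using h r (by simpa using hr)

/-- Only s = 1 is needed: modulo the earlier elements, superficiality puts y r into y I₁I₂ⁿ, and
regularity cancels y. -/
lemma exists_injAt_of_isSuperficialSeq {I₁ I₂ : Ideal R} {k : ℕ} {x : Fin k → R}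
    (hreg : RingTheory.Sequence.IsWeaklyRegular R (List.ofFn x)) (hsup : IsSuperficialSeq I₁ I₂ x)
    {l : ℕ} (hl : l < k) :
    ∃ N, ∀ n ≥ N, InjAt (filtG I₁ I₂).N (extendSeq x) l n := by
  obtain ⟨-, r₀, hr₀, h⟩ := hsup ⟨l, hl⟩
  refine ⟨r₀ + 1, fun n hn r hr => ?_⟩
  obtain ⟨n, rfl⟩ := Nat.exists_eq_succ_of_ne_zero (by omega : n ≠ 0)
  have ha : initIdeal (extendSeq x) l = _ := initIdeal_extendSeq x ⟨l, hl⟩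
  have hX : extendSeq x l = x ⟨l, hl⟩ := extendSeq_of_lt x ⟨l, hl⟩
  have hmul := fun {s : R} => mem_initIdeal_of_mul_mem hreg ⟨l, hl⟩ (r := s)
  rw [ha, hX] at hr
  rw [ha]
  simp only [ha] at hmul
  set a := Ideal.span (x '' {j | j < ⟨l, hl⟩})
  set y := x ⟨l, hl⟩
  set π := Ideal.Quotient.mk a
  have hN : ∀ m, (I₁.map π) ^ 1 * (I₂.map π) ^ m = Ideal.map π ((filtG I₁ I₂).N (m + 1)) := by
    intro m
    change _ = (I₁ * I₂ ^ m).map π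
    rw [pow_one, Ideal.map_mul, Ideal.map_pow]
  have hmem : ∀ (J : Ideal R) (s : R), π s ∈ J.map π ↔ s ∈ J ⊔ a := by
    intro J s
    rw [← Ideal.mem_comap, Ideal.comap_map_of_surjective _ Ideal.Quotient.mk_surjective,
      ← RingHom.ker_eq_comap_bot, Ideal.mk_ker]
  have h1 : π y * π r ∈ Ideal.span {π y} ⊓ ((I₁.map π) ^ 1 * (I₂.map π) ^ (n + 1)) := by
    refine ⟨Ideal.mul_mem_right _ _ (Ideal.mem_span_singleton_self _), ?_⟩
    rw [hN, ← map_mul]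
    exact (hmem _ _).2 hr
  rw [h (n + 1) 1 (by omega), Nat.add_sub_cancel, hN, Ideal.mem_span_singleton_mul] at h1
  obtain ⟨z, hz, hzy⟩ := h1
  obtain ⟨z, rfl⟩ := Ideal.Quotient.mk_surjective z
  have h2 : r - z ∈ a := by
    apply hmul
    rw [← Ideal.Quotient.eq_zero_iff_mem, mul_sub, map_sub, map_mul, map_mul]
    exact sub_eq_zero.2 hzy.symm
  rw [← sub_add_cancel r z]
  exact add_mem (Submodule.mem_sup_right h2) ((hmem _ _).1 hz)

end Superficial

/-! ### Subquotients and lengths in exact sequences -/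

section SubQuot

variable {A M M' M'' : Type*} [CommRing A] [AddCommGroup M] [Module A M] [AddCommGroup M']
  [Module A M'] [AddCommGroup M''] [Module A M'']

namespace SubQuot

/-- The class of an element in a subquotient. -/
def mk {N : Submodule A M} (P : Submodule A M) (z : N) : SubQuot N P :=
  Submodule.Quotient.mk (p := P.submoduleOf N) z

lemma mk_surjective (N P : Submodule A M) (q : SubQuot N P) : ∃ z : N, mk P z = q :=
  Submodule.Quotient.mk_surjective _ q

lemma mk_eq_zero_iff {N : Submodule A M} (P : Submodule A M) (z : N) :
    mk P z = 0 ↔ (z : M) ∈ P :=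
  Submodule.Quotient.mk_eq_zero (p := P.submoduleOf N)

lemma mk_sub {N : Submodule A M} (P : Submodule A M) (z w : N) :
    mk P (z - w) = mk P z - mk P w := rfl

lemma mk_eq_mk_iff {N : Submodule A M} (P : Submodule A M) (z w : N) :
    mk P z = mk P w ↔ (z - w : M) ∈ P := by
  rw [← sub_eq_zero, ← mk_sub, mk_eq_zero_iff]; rfl

/-- The map of subquotients induced by a linear map. -/
def map {N P : Submodule A M} {N' P' : Submodule A M'} (φ : M →ₗ[A] M')
    (hN : ∀ z ∈ N, φ z ∈ N') (hP : ∀ z ∈ P, φ z ∈ P') : SubQuot N P →ₗ[A] SubQuot N' P' :=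
  Submodule.mapQ (P.submoduleOf N) (P'.submoduleOf N') (φ.restrict hN) fun z hz => hP z hz

lemma map_mk {N P : Submodule A M} {N' P' : Submodule A M'} (φ : M →ₗ[A] M')
    (hN : ∀ z ∈ N, φ z ∈ N') (hP : ∀ z ∈ P, φ z ∈ P') (z : N) :
    map φ hN hP (mk P z) = mk P' ⟨φ z, hN z z.2⟩ := rfl

lemma exact_map {N P : Submodule A M} {N' P' : Submodule A M'} {N'' P'' : Submodule A M''}
    {φ : M →ₗ[A] M'} {ψ : M' →ₗ[A] M''} (hN : ∀ z ∈ N, φ z ∈ N') (hP : ∀ z ∈ P, φ z ∈ P')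
    (hN' : ∀ z ∈ N', ψ z ∈ N'') (hP' : ∀ z ∈ P', ψ z ∈ P'')
    (h₁ : ∀ z ∈ N, ψ (φ z) ∈ P'') (h₂ : ∀ z ∈ N', ψ z ∈ P'' → ∃ y ∈ N, φ y - z ∈ P') :
    Function.Exact (map φ hN hP) (map ψ hN' hP') := by
  intro q
  obtain ⟨z, rfl⟩ := mk_surjective _ _ q
  rw [map_mk, mk_eq_zero_iff]
  refine ⟨fun h => ?_, fun ⟨y, hy⟩ => ?_⟩
  · obtain ⟨y, hy, hyz⟩ := h₂ z z.2 h
    exact ⟨mk P ⟨y, hy⟩, (mk_eq_mk_iff _ _ _).2 hyz⟩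
  · obtain ⟨y, rfl⟩ := mk_surjective _ _ y
    have h := (mk_eq_mk_iff _ _ _).1 hy
    have h3 := hP' _ h
    rw [map_sub] at h3
    have h4 := sub_mem (h₁ y y.2) h3
    simpa using h4

lemma map_eq_zero_iff_forall {N P : Submodule A M} {N' P' : Submodule A M'} {φ : M →ₗ[A] M'}
    (hN : ∀ z ∈ N, φ z ∈ N') (hP : ∀ z ∈ P, φ z ∈ P') :
    LinearMap.ker (map φ hN hP) = ⊥ ↔ ∀ z ∈ N, φ z ∈ P' → z ∈ P := by
  rw [Submodule.eq_bot_iff]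
  refine ⟨fun h z hz hφ => ?_, fun h q hq => ?_⟩
  · exact (mk_eq_zero_iff P ⟨z, hz⟩).1 (h _ ((mk_eq_zero_iff _ _).2 hφ))
  · obtain ⟨z, rfl⟩ := mk_surjective _ _ q
    exact (mk_eq_zero_iff _ _).2 (h z z.2 ((mk_eq_zero_iff _ _).1 hq))

lemma length_le (N P : Submodule A M) : Module.length A (SubQuot N P) ≤ Module.length A (M ⧸ P) := by
  change Module.length A (N ⧸ P.submoduleOf N) ≤ _
  have hle : P.submoduleOf N ≤ Submodule.comap N.subtype P := le_rfl
  refine Module.length_le_of_injective (Submodule.mapQ (P.submoduleOf N) P N.subtype hle) ?_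
  rw [← LinearMap.ker_eq_bot, Submodule.eq_bot_iff]
  intro q hq
  obtain ⟨z, rfl⟩ := mk_surjective N P q
  exact (mk_eq_zero_iff _ _).2 ((Submodule.Quotient.mk_eq_zero P).1 hq)

lemma length_eq_zero {N P : Submodule A M} (h : N ≤ P) : Module.length A (SubQuot N P) = 0 := by
  rw [Module.length_eq_zero_iff, subsingleton_iff_forall_eq 0]
  intro q
  obtain ⟨z, rfl⟩ := mk_surjective _ _ q
  exact (mk_eq_zero_iff _ _).2 (h z.2)

end SubQuot

lemma length_add_length_coker (f : M →ₗ[A] M') :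
    Module.length A M + Module.length A (M' ⧸ LinearMap.range f) =
      Module.length A (LinearMap.ker f) + Module.length A M' := by
  rw [Module.length_eq_add_of_exact (LinearMap.range f).subtype (LinearMap.range f).mkQ
      (Submodule.subtype_injective _) (Submodule.mkQ_surjective _)
      (LinearMap.exact_subtype_mkQ _),
    Module.length_eq_add_of_exact (LinearMap.ker f).subtype f.rangeRestrict
      (Submodule.subtype_injective _) f.surjective_rangeRestrict
      (by rw [LinearMap.exact_iff, LinearMap.ker_rangeRestrict, Submodule.range_subtype]),
    add_assoc]

lemma length_eq_coker_add_ker {M₁ M₂ M₃ M₄ M₅ : Type*} [AddCommGroup M₁] [Module A M₁]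
    [AddCommGroup M₂] [Module A M₂] [AddCommGroup M₃] [Module A M₃] [AddCommGroup M₄] [Module A M₄]
    [AddCommGroup M₅] [Module A M₅] {d : M₁ →ₗ[A] M₂} {i : M₂ →ₗ[A] M₃} {p : M₃ →ₗ[A] M₄}
    {d' : M₄ →ₗ[A] M₅} (h₁ : Function.Exact d i) (h₂ : Function.Exact i p)
    (h₃ : Function.Exact p d') :
    Module.length A M₃ =
      Module.length A (M₂ ⧸ LinearMap.range d) + Module.length A (LinearMap.ker d') := by
  rw [LinearMap.exact_iff] at h₁ h₂ h₃
  rw [h₃, ← h₁, i.quotKerEquivRange.length_eq, ← h₂]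
  exact Module.length_eq_add_of_exact (LinearMap.ker p).subtype p.rangeRestrict
    (Submodule.subtype_injective _) p.surjective_rangeRestrict
    (by rw [LinearMap.exact_iff, LinearMap.ker_rangeRestrict, Submodule.range_subtype])

end SubQuot

/-! ### Koszul homology modulo the filtration and its long exact sequence -/

section Koszul

/-- The chain with given coefficients at the sets not containing, resp. containing, `l`. -/
def coneChain {S : Type*} (l : ℕ) (a b : Finset ℕ → S) : Finset ℕ → S :=
  fun s => if l ∈ s then b (s.erase l) else a s

lemma coneChain_of_notMem {S : Type*} {l : ℕ} (a b : Finset ℕ → S) {s : Finset ℕ} (h : l ∉ s) :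
    coneChain l a b s = a s := if_neg h

lemma coneChain_insert {S : Type*} {l : ℕ} (a b : Finset ℕ → S) {s : Finset ℕ} (h : l ∉ s) :
    coneChain l a b (insert l s) = b s := by
  rw [coneChain, if_pos (Finset.mem_insert_self _ _), Finset.erase_insert h]

/-- The Koszul differential of `x₁, …, x_l`, on functions on finite sets of natural numbers. -/
def kDiff (X : ℕ → R) (l : ℕ) : (Finset ℕ → R) →ₗ[R] (Finset ℕ → R) :=
  LinearMap.pi fun t => ∑ i ∈ Finset.range l \ t,
    ((-1) ^ (t.filter (· < i)).card * X i) • LinearMap.proj (insert i t)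

lemma kDiff_apply (X : ℕ → R) (l : ℕ) (f : Finset ℕ → R) (t : Finset ℕ) :
    kDiff X l f t = ∑ i ∈ Finset.range l \ t,
      (-1) ^ (t.filter (· < i)).card * X i * f (insert i t) := by
  simp [kDiff]

/-- Chains are functions on all finite sets of naturals, so that the ambient module does not change
with l; only the values on subsets of `range l` of the right size matter. -/
lemma kDiff_congr {X : ℕ → R} {l : ℕ} {f g : Finset ℕ → R} {t : Finset ℕ}
    (ht : t ⊆ Finset.range l) (h : ∀ s ⊆ Finset.range l, s.card = t.card + 1 → f s = g s) :
    kDiff X l f t = kDiff X l g t := by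
  rw [kDiff_apply, kDiff_apply]
  refine Finset.sum_congr rfl fun i hi => ?_
  rw [Finset.mem_sdiff] at hi
  rw [h _ (Finset.insert_subset hi.1 ht) (Finset.card_insert_of_notMem hi.2)]

lemma notMem_of_subset_range {l : ℕ} {t : Finset ℕ} (ht : t ⊆ Finset.range l) : l ∉ t :=
  fun h => by simpa using ht h

/-- All elements of t are below l, so the new term has sign (-1)^|t|: this is the cone differential.
-/
lemma kDiff_succ_of_subset (X : ℕ → R) {l : ℕ} (f : Finset ℕ → R) {t : Finset ℕ}
    (ht : t ⊆ Finset.range l) :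
    kDiff X (l + 1) f t = kDiff X l f t + (-1) ^ t.card * (X l * f (insert l t)) := by
  have hl := notMem_of_subset_range ht
  have e : Finset.range (l + 1) \ t = insert l (Finset.range l \ t) := by
    rw [Finset.range_add_one, Finset.insert_sdiff_of_notMem _ hl]
  have e' : t.filter (· < l) = t :=
    Finset.filter_true_of_mem fun i hi => Finset.mem_range.1 (ht hi)
  rw [kDiff_apply, kDiff_apply, e, Finset.sum_insert (by simp), e', add_comm, mul_assoc]

lemma kDiff_succ_insert (X : ℕ → R) {l : ℕ} (f : Finset ℕ → R) {t : Finset ℕ}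
    (ht : t ⊆ Finset.range l) :
    kDiff X (l + 1) f (insert l t) = kDiff X l (fun s => f (insert l s)) t := by
  have hl := notMem_of_subset_range ht
  have e : Finset.range (l + 1) \ insert l t = Finset.range l \ t := by
    ext i
    simp only [Finset.mem_sdiff, Finset.mem_range, Finset.mem_insert, not_or]
    exact ⟨fun ⟨h, h', h''⟩ => ⟨by omega, h''⟩, fun ⟨h, h'⟩ => ⟨by omega, by omega, h'⟩⟩
  rw [kDiff_apply, kDiff_apply, e]
  refine Finset.sum_congr rfl fun i hi => ?_
  rw [Finset.mem_sdiff, Finset.mem_range] at hi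
  rw [Finset.filter_insert, if_neg (by omega), Finset.insert_comm]

/-- The cycles of degree `j` of the Koszul complex of `x₁, …, x_l` modulo the filtration `F`. -/
def kCycles (F : ℕ → Ideal R) (X : ℕ → R) (l j n : ℕ) : Submodule R (Finset ℕ → R) where
  carrier := {f | ∀ t ⊆ Finset.range l, t.card + 1 = j → kDiff X l f t ∈ F (n - t.card)}
  add_mem' hf hg t ht hj := by
    rw [map_add]; exact add_mem (hf t ht hj) (hg t ht hj)
  zero_mem' t _ _ := by rw [map_zero]; exact zero_mem _
  smul_mem' r f hf t ht hj := by
    rw [map_smul]; exact Submodule.smul_mem _ r (hf t ht hj)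

/-- The boundaries of degree `j` of the Koszul complex of `x₁, …, x_l` modulo the
filtration `F`. -/
def kBoundaries (F : ℕ → Ideal R) (X : ℕ → R) (l j n : ℕ) : Submodule R (Finset ℕ → R) where
  carrier := {f | ∃ g, ∀ s ⊆ Finset.range l, s.card = j → f s - kDiff X l g s ∈ F (n - j)}
  add_mem' := by
    rintro f f' ⟨g, hg⟩ ⟨g', hg'⟩
    refine ⟨g + g', fun s hs hj => ?_⟩
    rw [map_add, Pi.add_apply, Pi.add_apply, add_sub_add_comm]
    exact add_mem (hg s hs hj) (hg' s hs hj)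
  zero_mem' := ⟨0, fun s _ _ => by simp⟩
  smul_mem' := by
    rintro r f ⟨g, hg⟩
    refine ⟨r • g, fun s hs hj => ?_⟩
    rw [map_smul, Pi.smul_apply, Pi.smul_apply, ← smul_sub]
    exact Submodule.smul_mem _ r (hg s hs hj)

lemma mem_kCycles {F : ℕ → Ideal R} {X : ℕ → R} {l j n : ℕ} {f : Finset ℕ → R} :
    f ∈ kCycles F X l j n ↔
      ∀ t ⊆ Finset.range l, t.card + 1 = j → kDiff X l f t ∈ F (n - t.card) := Iff.rfl

lemma mem_kBoundaries {F : ℕ → Ideal R} {X : ℕ → R} {l j n : ℕ} {f : Finset ℕ → R} :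
    f ∈ kBoundaries F X l j n ↔
      ∃ g, ∀ s ⊆ Finset.range l, s.card = j → f s - kDiff X l g s ∈ F (n - j) := Iff.rfl

/-- The Koszul homology of `x₁, …, x_l` modulo the filtration `F`. -/
abbrev KHom (F : ℕ → Ideal R) (X : ℕ → R) (l j n : ℕ) : Type u :=
  SubQuot (kCycles F X l j n) (kBoundaries F X l j n)

/-- Restriction to sets not containing `l`. -/
def awayMap (l : ℕ) : (Finset ℕ → R) →ₗ[R] (Finset ℕ → R) :=
  LinearMap.pi fun s => if l ∈ s then 0 else LinearMap.proj s

/-- The coefficients at the sets containing `l`. -/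
def linkMap (l : ℕ) : (Finset ℕ → R) →ₗ[R] (Finset ℕ → R) :=
  LinearMap.pi fun s => LinearMap.proj (insert l s)

lemma awayMap_apply (l : ℕ) (f : Finset ℕ → R) (s : Finset ℕ) :
    awayMap l f s = if l ∈ s then 0 else f s := by
  unfold awayMap
  split_ifs with h <;> simp [h]

lemma linkMap_apply (l : ℕ) (f : Finset ℕ → R) (s : Finset ℕ) :
    linkMap l f s = f (insert l s) := rfl

lemma kDiff_coneChain_of_subset (X : ℕ → R) {l : ℕ} (a b : Finset ℕ → R) {t : Finset ℕ}
    (ht : t ⊆ Finset.range l) :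
    kDiff X (l + 1) (coneChain l a b) t = kDiff X l a t + (-1) ^ t.card * (X l * b t) := by
  rw [kDiff_succ_of_subset X _ ht, coneChain_insert _ _ (notMem_of_subset_range ht)]
  congr 1
  exact kDiff_congr ht fun s hs _ => coneChain_of_notMem _ _ (notMem_of_subset_range hs)

lemma kDiff_coneChain_insert (X : ℕ → R) {l : ℕ} (a b : Finset ℕ → R) {t : Finset ℕ}
    (ht : t ⊆ Finset.range l) :
    kDiff X (l + 1) (coneChain l a b) (insert l t) = kDiff X l b t := by
  rw [kDiff_succ_insert X _ ht]
  exact kDiff_congr ht fun s hs _ => coneChain_insert _ _ (notMem_of_subset_range hs)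

lemma forall_subset_range_succ {l : ℕ} {P : Finset ℕ → Prop} :
    (∀ t ⊆ Finset.range (l + 1), P t) ↔
      (∀ t ⊆ Finset.range l, P t) ∧ ∀ t ⊆ Finset.range l, P (insert l t) := by
  rw [Finset.range_add_one]
  refine ⟨fun h => ⟨fun t ht => h t (ht.trans (Finset.subset_insert _ _)),
    fun t ht => h _ (Finset.insert_subset_insert _ ht)⟩, fun ⟨h₁, h₂⟩ t ht => ?_⟩
  by_cases hl : l ∈ t
  · rw [← Finset.insert_erase hl]
    exact h₂ _ (by rwa [← Finset.subset_insert_iff])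
  · exact h₁ t ((Finset.subset_insert_iff_of_notMem hl).1 ht)

variable {F : ℕ → Ideal R} {X : ℕ → R}

lemma mem_kCycles_succ {l j n : ℕ} {f : Finset ℕ → R} :
    f ∈ kCycles F X (l + 1) (j + 1) (n + 1) ↔
      (∀ t ⊆ Finset.range l, t.card = j →
        kDiff X l f t + (-1) ^ j * (X l * f (insert l t)) ∈ F (n + 1 - j)) ∧
      linkMap l f ∈ kCycles F X l j n := by
  rw [mem_kCycles, forall_subset_range_succ, mem_kCycles]
  refine and_congr (forall₂_congr fun t ht => ?_) (forall₂_congr fun t ht => ?_)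
  · rw [add_left_inj]
    refine forall_congr' fun hj => ?_
    rw [kDiff_succ_of_subset X f ht, hj]
  · rw [Finset.card_insert_of_notMem (notMem_of_subset_range ht), add_left_inj,
      kDiff_succ_insert X f ht, Nat.add_sub_add_right]
    rfl

lemma mem_kBoundaries_succ {l j n : ℕ} {f : Finset ℕ → R} :
    f ∈ kBoundaries F X (l + 1) (j + 1) (n + 1) ↔ ∃ a b,
      (∀ s ⊆ Finset.range l, s.card = j + 1 →
        f s - (kDiff X l a s + (-1) ^ (j + 1) * (X l * b s)) ∈ F (n - j)) ∧
      ∀ s ⊆ Finset.range l, s.card = j → linkMap l f s - kDiff X l b s ∈ F (n - j) := by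
  rw [mem_kBoundaries]
  simp only [forall_subset_range_succ, Nat.add_sub_add_right]
  refine ⟨fun ⟨g, hg₁, hg₂⟩ => ⟨g, linkMap l g, fun s hs hj => ?_, fun s hs hj => ?_⟩,
    fun ⟨a, b, h₁, h₂⟩ => ⟨coneChain l a b, fun s hs hj => ?_, fun s hs hj => ?_⟩⟩
  · have := hg₁ s hs hj
    rwa [kDiff_succ_of_subset X g hs, hj] at this
  · have := hg₂ s hs (by rw [Finset.card_insert_of_notMem (notMem_of_subset_range hs), hj])
    rwa [kDiff_succ_insert X g hs] at this
  · rw [kDiff_coneChain_of_subset X a b hs, hj]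
    exact h₁ s hs hj
  · rw [Finset.card_insert_of_notMem (notMem_of_subset_range hs), add_left_inj] at hj
    rw [kDiff_coneChain_insert X a b hs]
    exact h₂ s hs hj

/-- Subtraction is truncated: for j > n both indices are 0, where the filtration is all of R. -/
lemma mul_mem_sub (hF0 : F 0 = ⊤) {y : R} (hmul : ∀ n, ∀ r ∈ F n, y * r ∈ F (n + 1)) {n j : ℕ}
    {r : R} (hr : r ∈ F (n - j)) : y * r ∈ F (n + 1 - j) := by
  by_cases h : j ≤ n
  · rw [show n + 1 - j = n - j + 1 by omega]
    exact hmul _ _ hr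
  · rw [show n + 1 - j = 0 by omega, hF0]
    trivial

lemma smul_mem_kCycles (hF0 : F 0 = ⊤) (hmul : ∀ i n, ∀ r ∈ F n, X i * r ∈ F (n + 1)) (i : ℕ)
    {l j n : ℕ} : ∀ f ∈ kCycles F X l j n,
      LinearMap.lsmul R (Finset ℕ → R) (X i) f ∈ kCycles F X l j (n + 1) := by
  intro f hf t ht hj
  rw [LinearMap.lsmul_apply, map_smul]
  exact mul_mem_sub hF0 (hmul i) (hf t ht hj)

lemma smul_mem_kBoundaries (hF0 : F 0 = ⊤) (hmul : ∀ i n, ∀ r ∈ F n, X i * r ∈ F (n + 1)) (i : ℕ)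
    {l j n : ℕ} : ∀ f ∈ kBoundaries F X l j n,
      LinearMap.lsmul R (Finset ℕ → R) (X i) f ∈ kBoundaries F X l j (n + 1) := by
  rintro f ⟨g, hg⟩
  refine ⟨X i • g, fun s hs hj => ?_⟩
  rw [LinearMap.lsmul_apply, map_smul, Pi.smul_apply, Pi.smul_apply, ← smul_sub]
  exact mul_mem_sub hF0 (hmul i) (hg s hs hj)

/-- Multiplication by `x_{l+1}` on the Koszul homology of `x₁, …, x_l`. -/
def kMul (hF0 : F 0 = ⊤) (hmul : ∀ i n, ∀ r ∈ F n, X i * r ∈ F (n + 1)) (l j n : ℕ) :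
    KHom F X l j n →ₗ[R] KHom F X l j (n + 1) :=
  SubQuot.map _ (smul_mem_kCycles hF0 hmul l) (smul_mem_kBoundaries hF0 hmul l)

lemma linkMap_awayMap {l : ℕ} (f : Finset ℕ → R) : linkMap l (awayMap l f) = 0 := by
  funext s
  rw [linkMap_apply, awayMap_apply, if_pos (Finset.mem_insert_self _ _)]
  rfl

lemma awayMap_of_subset {l : ℕ} (f : Finset ℕ → R) {s : Finset ℕ} (hs : s ⊆ Finset.range l) :
    awayMap l f s = f s := by
  rw [awayMap_apply, if_neg (notMem_of_subset_range hs)]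

lemma awayMap_mem_kCycles {l j n : ℕ} : ∀ f ∈ kCycles F X l (j + 1) (n + 1),
    awayMap l f ∈ kCycles F X (l + 1) (j + 1) (n + 1) := by
  intro f hf
  rw [mem_kCycles_succ, linkMap_awayMap]
  refine ⟨fun t ht hj => ?_, zero_mem _⟩
  rw [awayMap_apply, if_pos (Finset.mem_insert_self _ _), mul_zero, mul_zero, add_zero,
    kDiff_congr ht fun s hs _ => awayMap_of_subset f hs, ← hj]
  exact hf t ht (by rw [hj])

lemma awayMap_mem_kBoundaries {l j n : ℕ} : ∀ f ∈ kBoundaries F X l (j + 1) (n + 1),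
    awayMap l f ∈ kBoundaries F X (l + 1) (j + 1) (n + 1) := by
  rintro f ⟨g, hg⟩
  rw [mem_kBoundaries_succ]
  refine ⟨g, 0, fun s hs hj => ?_, fun s hs hj => ?_⟩
  · have := hg s hs hj
    rw [Nat.add_sub_add_right] at this
    rw [awayMap_of_subset f hs, Pi.zero_apply, mul_zero, mul_zero, add_zero]
    exact this
  · rw [linkMap_awayMap, map_zero, Pi.zero_apply, sub_zero]
    exact zero_mem _

lemma linkMap_mem_kCycles {l j n : ℕ} : ∀ f ∈ kCycles F X (l + 1) (j + 1) (n + 1),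
    linkMap l f ∈ kCycles F X l j n := fun _ hf => (mem_kCycles_succ.1 hf).2

lemma linkMap_mem_kBoundaries {l j n : ℕ} : ∀ f ∈ kBoundaries F X (l + 1) (j + 1) (n + 1),
    linkMap l f ∈ kBoundaries F X l j n := by
  intro f hf
  obtain ⟨a, b, -, h⟩ := mem_kBoundaries_succ.1 hf
  exact ⟨b, h⟩

/-- This and the next two lemmas form the long exact sequence of the cone. The index n drops by one
along `linkMap` because x_{l+1} raises the filtration degree by one. -/
lemma exact_kMul_away (hF0 : F 0 = ⊤) (hmul : ∀ i n, ∀ r ∈ F n, X i * r ∈ F (n + 1)) (l j n : ℕ) :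
    Function.Exact (kMul hF0 hmul l (j + 1) n)
      (SubQuot.map (awayMap l) awayMap_mem_kCycles awayMap_mem_kBoundaries :
        KHom F X l (j + 1) (n + 1) →ₗ[R] KHom F X (l + 1) (j + 1) (n + 1)) := by
  refine SubQuot.exact_map _ _ _ _ (fun z hz => ?_) fun z hz hz' => ?_
  · rw [mem_kBoundaries_succ]
    -- Up to sign, x_{l+1} z is the cone boundary of z placed on the sets containing l; the other
    -- component of that boundary is negligible because z is a cycle.
    refine ⟨0, (-1 : R) ^ (j + 1) • z, fun s hs hj => ?_, fun s hs hj => ?_⟩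
    · rw [awayMap_of_subset _ hs, map_zero, Pi.zero_apply, Pi.smul_apply, LinearMap.lsmul_apply,
        Pi.smul_apply, smul_eq_mul, smul_eq_mul, mul_left_comm (X l), ← mul_assoc, ← pow_add,
        Even.neg_one_pow ⟨j + 1, rfl⟩, zero_add, one_mul, sub_self]
      exact zero_mem _
    · rw [linkMap_awayMap, Pi.zero_apply, zero_sub, map_smul, Pi.smul_apply, neg_mem_iff, ← hj]
      exact Submodule.smul_mem _ _ (hz s hs (by rw [hj]))
  · obtain ⟨a, b, h₁, h₂⟩ := mem_kBoundaries_succ.1 hz'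
    refine ⟨(-1 : R) ^ (j + 1) • b, Submodule.smul_mem _ _ fun t ht hj => ?_, -a,
      fun s hs hj => ?_⟩
    · have := h₂ t ht (by omega)
      rw [linkMap_awayMap, Pi.zero_apply, zero_sub, neg_mem_iff] at this
      rwa [show t.card = j by omega]
    · have := h₁ s hs hj
      rw [awayMap_of_subset _ hs] at this
      rw [Nat.add_sub_add_right, ← neg_mem_iff]
      convert this using 1
      simp only [Pi.sub_apply, LinearMap.lsmul_apply, Pi.smul_apply, smul_eq_mul, map_neg,
        Pi.neg_apply]
      ring

lemma exact_away_link (hF0 : F 0 = ⊤) (hmul : ∀ i n, ∀ r ∈ F n, X i * r ∈ F (n + 1)) (l j n : ℕ) :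
    Function.Exact
      (SubQuot.map (awayMap l) awayMap_mem_kCycles awayMap_mem_kBoundaries :
        KHom F X l (j + 1) (n + 1) →ₗ[R] KHom F X (l + 1) (j + 1) (n + 1))
      (SubQuot.map (linkMap l) linkMap_mem_kCycles linkMap_mem_kBoundaries :
        KHom F X (l + 1) (j + 1) (n + 1) →ₗ[R] KHom F X l j n) := by
  refine SubQuot.exact_map _ _ _ _ (fun z _ => ?_) fun z hz hz' => ?_
  · rw [linkMap_awayMap]; exact zero_mem _
  · obtain ⟨b, hb⟩ := hz'
    have h₁ := (mem_kCycles_succ.1 hz).1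
    -- Here b bounds the link of z; subtracting its cone boundary from z leaves a negligible link
    -- and, on the sets avoiding l, this cycle.
    refine ⟨z - ((-1 : R) ^ (j + 1) * X l) • b, fun t ht hj => ?_, ?_⟩
    · obtain rfl : t.card = j := by omega
      have h₂ := Ideal.mul_mem_left _ ((-1) ^ t.card) (mul_mem_sub hF0 (hmul l) (hb t ht rfl))
      have h₃ := sub_mem (h₁ t ht rfl) h₂
      rw [map_sub, map_smul, Pi.sub_apply, Pi.smul_apply, smul_eq_mul]
      convert h₃ using 1
      rw [linkMap_apply]
      ring
    · rw [mem_kBoundaries_succ]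
      refine ⟨0, -b, fun s hs hj => ?_, fun s hs hj => ?_⟩
      · rw [Pi.sub_apply, awayMap_of_subset _ hs, map_zero]
        simp only [Pi.sub_apply, Pi.smul_apply, smul_eq_mul, Pi.neg_apply, Pi.zero_apply]
        convert zero_mem (F (n - j)) using 1
        ring
      · have := hb s hs hj
        rw [map_sub, linkMap_awayMap, zero_sub, map_neg, Pi.neg_apply, Pi.neg_apply, ← neg_sub',
          neg_mem_iff]
        exact this

lemma exact_link_kMul (hF0 : F 0 = ⊤) (hmul : ∀ i n, ∀ r ∈ F n, X i * r ∈ F (n + 1)) (l j n : ℕ) :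
    Function.Exact
      (SubQuot.map (linkMap l) linkMap_mem_kCycles linkMap_mem_kBoundaries :
        KHom F X (l + 1) (j + 1) (n + 1) →ₗ[R] KHom F X l j n)
      (kMul hF0 hmul l j n) := by
  refine SubQuot.exact_map _ _ _ _ (fun z hz => ?_) fun z hz hz' => ?_
  · have h₁ := (mem_kCycles_succ.1 hz).1
    refine ⟨-((-1 : R) ^ j • z), fun s hs hj => ?_⟩
    have h₂ := Ideal.mul_mem_left _ ((-1) ^ j) (h₁ s hs hj)
    convert h₂ using 1
    simp only [LinearMap.lsmul_apply, map_neg, map_smul, Pi.smul_apply, Pi.neg_apply, smul_eq_mul,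
      linkMap_apply, mul_add]
    rw [← mul_assoc ((-1) ^ j) ((-1) ^ j), ← pow_add, Even.neg_one_pow ⟨j, rfl⟩]
    ring
  · obtain ⟨g, hg⟩ := hz'
    have hlink : ∀ s ⊆ Finset.range l,
        linkMap l (coneChain l (-((-1 : R) ^ j • g)) z) s = z s := fun s hs =>
      coneChain_insert _ _ (notMem_of_subset_range hs)
    -- If g bounds x_{l+1} z, then z on the sets containing l, corrected by g with this sign, is a
    -- cycle of the cone.
    refine ⟨coneChain l (-((-1 : R) ^ j • g)) z, ?_, 0, fun s hs hj => ?_⟩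
    · rw [mem_kCycles_succ]
      refine ⟨fun t ht hj => ?_, fun t ht hj => ?_⟩
      · have h₂ := Ideal.mul_mem_left _ ((-1) ^ j) (hg t ht hj)
        rw [← hj, ← kDiff_succ_of_subset X _ ht, kDiff_coneChain_of_subset X _ _ ht, hj]
        convert h₂ using 1
        simp only [LinearMap.lsmul_apply, map_neg, map_smul, Pi.smul_apply, Pi.neg_apply,
          smul_eq_mul]
        ring
      · rw [kDiff_congr ht fun s hs _ => hlink s hs]
        exact hz t ht hj
    · rw [Pi.sub_apply, hlink s hs, map_zero, sub_self, Pi.zero_apply, sub_zero]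
      exact zero_mem _

end Koszul

/-! ### Finiteness of lengths and degree zero homology -/

section Lengths

variable {F : ℕ → Ideal R} {X : ℕ → R}

/-- Chains with values in F_{n-j} on j-subsets are boundaries, so the homology is a subquotient of a
finite power of R/F_{n-j}. -/
lemma length_kHom_ne_top (hfin : ∀ n, Module.length R (R ⧸ F n) ≠ ⊤) (l j n : ℕ) :
    Module.length R (KHom F X l j n) ≠ ⊤ := by
  let S := Finset.powersetCard j (Finset.range l)
  let ψ : (Finset ℕ → R) →ₗ[R] (S → R ⧸ F (n - j)) :=
    LinearMap.pi fun s => (F (n - j)).mkQ ∘ₗ LinearMap.proj s.1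
  have hker : LinearMap.ker ψ ≤ kBoundaries F X l j n := by
    intro f hf
    refine ⟨0, fun s hs hj => ?_⟩
    have := congrFun (LinearMap.mem_ker.1 hf) ⟨s, Finset.mem_powersetCard.2 ⟨hs, hj⟩⟩
    rw [map_zero, Pi.zero_apply, sub_zero]
    exact (Submodule.Quotient.mk_eq_zero _).1 this
  have h₁ : Module.length R ((Finset ℕ → R) ⧸ kBoundaries F X l j n) ≤
      Module.length R ((Finset ℕ → R) ⧸ LinearMap.ker ψ) :=
    Module.length_le_of_surjective (Submodule.factor hker) (Submodule.factor_surjective hker)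
  have h₂ : Module.length R ((Finset ℕ → R) ⧸ LinearMap.ker ψ) ≤
      Module.length R (S → R ⧸ F (n - j)) := by
    rw [ψ.quotKerEquivRange.length_eq]
    exact Module.length_le_of_injective _ (Submodule.subtype_injective _)
  refine ne_top_of_le_ne_top ?_ ((SubQuot.length_le _ _).trans (h₁.trans h₂))
  rw [Module.length_pi_of_fintype]
  rw [Finset.sum_const, nsmul_eq_mul]
  exact WithTop.mul_ne_top (ENat.natCast_ne_top _) (hfin _)

lemma kBoundaries_zero (hF0 : F 0 = ⊤) (l j : ℕ) : kBoundaries F X l j 0 = ⊤ :=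
  eq_top_iff.2 fun f _ => ⟨0, fun s _ _ => by rw [Nat.zero_sub, hF0]; trivial⟩

lemma kBoundaries_range_zero (j n : ℕ) : kBoundaries F X 0 (j + 1) n = ⊤ := by
  refine eq_top_iff.2 fun f _ => ⟨0, fun s hs hj => ?_⟩
  rw [Finset.range_zero, Finset.subset_empty] at hs
  simp [hs] at hj

lemma exists_kDiff_empty (X : ℕ → R) (l : ℕ) (r : R) :
    r ∈ initIdeal X l ↔ ∃ g, kDiff X l g ∅ = r := by
  induction l generalizing r with
  | zero => simp [initIdeal_zero, kDiff_apply, eq_comm]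
  | succ l ih =>
    rw [mem_initIdeal_succ]
    refine ⟨fun ⟨s, hs, b, hb⟩ => ?_, fun ⟨g, hg⟩ => ?_⟩
    · obtain ⟨g, rfl⟩ := (ih s).1 hs
      exact ⟨coneChain l g fun _ => b, by
        rw [kDiff_coneChain_of_subset X _ _ (Finset.empty_subset _), ← hb]; simp⟩
    · refine ⟨_, (ih _).2 ⟨g, rfl⟩, g (insert l ∅), ?_⟩
      rw [← hg, kDiff_succ_of_subset X _ (Finset.empty_subset _)]; simp

/-- Every chain is a cycle in degree 0, so this identifies H_0 with R/(F_n + (x_1, …, x_l)). -/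
lemma mem_kBoundaries_degree_zero {l n : ℕ} {f : Finset ℕ → R} :
    f ∈ kBoundaries F X l 0 n ↔ f ∅ ∈ F n ⊔ initIdeal X l := by
  rw [mem_kBoundaries, Submodule.mem_sup]
  constructor
  · rintro ⟨g, hg⟩
    exact ⟨_, hg ∅ (Finset.empty_subset _) rfl, _, (exists_kDiff_empty X l _).2 ⟨g, rfl⟩,
      sub_add_cancel _ _⟩
  · rintro ⟨a, ha, b, hb, hab⟩
    obtain ⟨g, rfl⟩ := (exists_kDiff_empty X l b).1 hb
    refine ⟨g, fun s _ hj => ?_⟩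
    rw [Finset.card_eq_zero] at hj
    rw [hj, ← hab, add_sub_cancel_right]
    exact ha

lemma length_ker_kMul_zero_iff (hF0 : F 0 = ⊤) (hmul : ∀ i n, ∀ r ∈ F n, X i * r ∈ F (n + 1))
    (l n : ℕ) :
    Module.length R (LinearMap.ker (kMul hF0 hmul l 0 n)) = 0 ↔ InjAt F X l n := by
  rw [Module.length_eq_zero_iff, Submodule.subsingleton_iff_eq_bot, kMul,
    SubQuot.map_eq_zero_iff_forall]
  simp only [mem_kBoundaries_degree_zero, LinearMap.lsmul_apply, Pi.smul_apply, smul_eq_mul]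
  exact ⟨fun h r hr => h (fun _ => r) (fun t _ ht => by omega) hr, fun h f _ hf => h _ hf⟩

lemma lengthRelations (hF0 : F 0 = ⊤) (hmul : ∀ i n, ∀ r ∈ F n, X i * r ∈ F (n + 1))
    (hfin : ∀ n, Module.length R (R ⧸ F n) ≠ ⊤) {k : ℕ}
    (hev : ∀ l < k, ∃ N, ∀ n ≥ N, InjAt F X l n) :
    LengthRelations k (fun l j n => (Module.length R (KHom F X l j n)).toNat)
      (fun l j n => (Module.length R
        (KHom F X l j (n + 1) ⧸ LinearMap.range (kMul hF0 hmul l j n))).toNat)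
      (fun l j n => (Module.length R (LinearMap.ker (kMul hF0 hmul l j n))).toNat) := by
  have hh := length_kHom_ne_top (X := X) hfin
  have hc : ∀ l j n, Module.length R
      (KHom F X l j (n + 1) ⧸ LinearMap.range (kMul hF0 hmul l j n)) ≠ ⊤ := fun l j n =>
    ne_top_of_le_ne_top (hh l j (n + 1))
      (Module.length_le_of_surjective _ (Submodule.mkQ_surjective _))
  have hκle : ∀ l j n, Module.length R (LinearMap.ker (kMul hF0 hmul l j n)) ≤
      Module.length R (KHom F X l j n) := fun l j n =>
    Module.length_le_of_injective _ (Submodule.subtype_injective _)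
  have hκ : ∀ l j n, Module.length R (LinearMap.ker (kMul hF0 hmul l j n)) ≠ ⊤ := fun l j n =>
    ne_top_of_le_ne_top (hh l j n) (hκle l j n)
  have hinj : ∀ l n, (Module.length R (LinearMap.ker (kMul hF0 hmul l 0 n))).toNat = 0 ↔
      InjAt F X l n := fun l n => by
    rw [← length_ker_kMul_zero_iff hF0 hmul, ENat.toNat_eq_zero, or_iff_left (hκ l 0 n)]
  refine ⟨fun l j => ?_, fun j n => ?_, fun l j n => ?_, fun l j n => ?_, fun l j n => ?_,
    fun l hl => ?_, fun l hl h n => ?_⟩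
  · rw [SubQuot.length_eq_zero (by rw [kBoundaries_zero hF0]; exact le_top)]; rfl
  · rw [SubQuot.length_eq_zero (by rw [kBoundaries_range_zero]; exact le_top)]; rfl
  · rw [← ENat.toNat_add (hc _ _ _) (hκ _ _ _)]
    congr 1
    exact length_eq_coker_add_ker (exact_kMul_away hF0 hmul l j n) (exact_away_link hF0 hmul l j n)
      (exact_link_kMul hF0 hmul l j n)
  · rw [← ENat.toNat_add (hh _ _ _) (hc _ _ _), ← ENat.toNat_add (hκ _ _ _) (hh _ _ _),
      length_add_length_coker]
  · exact ENat.toNat_le_toNat (hκle l j n) (hh l j n)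
  · obtain ⟨N, hN⟩ := hev l hl
    exact ⟨N, fun n hn => (hinj l n).2 (hN n hn)⟩
  · simp only [hinj] at h ⊢
    exact injAt_of_injAt_succ hF0 hmul (hev l (by omega)) h n

end Lengths

lemma SubQuot.mk_mem_smul_top_iff {A M : Type*} [CommRing A] [AddCommGroup M] [Module A M]
    {N P : Submodule A M} (J : Ideal A) (z : N) :
    SubQuot.mk P z ∈ (J • ⊤ : Submodule A (SubQuot N P)) ↔ (z : M) ∈ J • N ⊔ P := by
  have e₁ : (J • ⊤ : Submodule A (SubQuot N P)) =
      (J • ⊤ : Submodule A N).map (P.submoduleOf N).mkQ := by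
    rw [Submodule.map_smul'', Submodule.map_top, Submodule.range_mkQ]
    rfl
  have e₂ : J • N = (J • ⊤ : Submodule A N).map N.subtype := by
    rw [Submodule.map_smul'', Submodule.map_top, Submodule.range_subtype]
  rw [e₁, e₂, Submodule.mem_sup]
  constructor
  · rintro ⟨y, hy, hyz⟩
    have h := (SubQuot.mk_eq_mk_iff P y z).1 hyz
    exact ⟨y, ⟨y, hy, rfl⟩, z - y, by rw [← neg_sub]; exact neg_mem h, add_sub_cancel _ _⟩
  · rintro ⟨_, ⟨y, hy, rfl⟩, p, hp, hyp⟩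
    refine ⟨y, hy, (SubQuot.mk_eq_mk_iff P y z).2 ?_⟩
    rw [← hyp, Submodule.subtype_apply, sub_add_cancel_left]
    exact neg_mem hp

variable {I₁ I₂ : Ideal R}

lemma mul_mem_filtG {y : R} (hy : y ∈ I₁ ⊓ I₂) (n : ℕ) (r : R) (hr : r ∈ (filtG I₁ I₂).N n) :
    y * r ∈ (filtG I₁ I₂).N (n + 1) :=
  (filtG I₁ I₂).smul_le n (Submodule.smul_mem_smul hy hr)

lemma filtG_zero : (filtG I₁ I₂).N 0 = ⊤ := rfl

/-! ### The associated graded module modulo x_1*, …, x_l* -/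

section Graded

variable {X : ℕ → R} (hX : ∀ i, X i ∈ I₁ ⊓ I₂)

/-- The element `x_i t` of the Rees algebra. -/
noncomputable def star (i : ℕ) : reesAlgebra (I₁ ⊓ I₂) :=
  ⟨Polynomial.monomial 1 (X i), reesAlgebra.monomial_mem.2 (by rw [pow_one]; exact hX i)⟩

lemma star_smul_coeff_zero (i : ℕ) (f : PolynomialModule R R) : (star hX i • f).coeff 0 = 0 := by
  rw [Subalgebra.smul_def, star, PolynomialModule.monomial_smul_apply, if_neg (by omega)]

lemma star_smul_coeff_succ (i n : ℕ) (f : PolynomialModule R R) :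
    (star hX i • f).coeff (n + 1) = X i * f.coeff n := by
  rw [Subalgebra.smul_def, star, PolynomialModule.monomial_smul_apply, if_pos (by omega),
    Nat.add_sub_cancel, smul_eq_mul]

lemma star_smul_single (i n : ℕ) (r : R) :
    star hX i • PolynomialModule.single R n r = PolynomialModule.single R (n + 1) (X i * r) := by
  rw [Subalgebra.smul_def, star, PolynomialModule.monomial_smul_single, smul_eq_mul, add_comm]

lemma single_mem_submodule (𝓕 : (I₁ ⊓ I₂).Filtration R) {n : ℕ} {r : R} (hr : r ∈ 𝓕.N n) :
    PolynomialModule.single R n r ∈ 𝓕.submodule := by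
  intro i
  rw [PolynomialModule.coeff_single, Finsupp.single_apply]
  split_ifs with h
  · rwa [← h]
  · exact zero_mem _

lemma coeff_mem_of_mem_smul_sup (l : ℕ) {f : PolynomialModule R R}
    (hf : f ∈ initIdeal (star hX) l • (filtG I₁ I₂).submodule ⊔ (filtGShift I₁ I₂).submodule)
    (n : ℕ) : f.coeff n ∈ (filtG I₁ I₂).N (n + 1) ⊔ initIdeal X l := by
  -- The condition on coefficients is itself the submodule of a filtration, hence stable under the
  -- Rees algebra; only the generators x_i t have to be tested.
  let T : (I₁ ⊓ I₂).Filtration R :=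
    filtGShift I₁ I₂ ⊔ (I₁ ⊓ I₂).trivialFiltration (initIdeal X l)
  suffices h : initIdeal (star hX) l • (filtG I₁ I₂).submodule ⊔ (filtGShift I₁ I₂).submodule ≤
      T.submodule from h hf n
  refine sup_le (Submodule.smul_le.2 fun a ha g _ => ?_) fun g hg i => Submodule.mem_sup_left (hg i)
  unfold initIdeal at ha
  induction ha using Submodule.span_induction with
  | mem a ha =>
    obtain ⟨i, hi, rfl⟩ := ha
    intro n
    refine Submodule.mem_sup_right ?_
    cases n with
    | zero => rw [star_smul_coeff_zero]; exact zero_mem _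
    | succ n =>
      rw [star_smul_coeff_succ]
      exact Ideal.mul_mem_right _ _ (mem_initIdeal_of_lt X hi)
  | zero => rw [zero_smul]; exact zero_mem _
  | add a b _ _ ha hb => rw [add_smul]; exact add_mem ha hb
  | smul c a _ ha => rw [smul_assoc]; exact Submodule.smul_mem _ c ha

lemma single_mem_smul (l n : ℕ) {s : R} (hs : s ∈ initIdeal X l * (filtG I₁ I₂).N n) :
    PolynomialModule.single R (n + 1) s ∈
      initIdeal (star hX) l • (filtG I₁ I₂).submodule := by
  induction hs using Submodule.mul_induction_on' with
  | mem_mul_mem a ha b hb =>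
    unfold initIdeal at ha
    -- With `b` free, a scalar c ∈ R can be moved from the ideal element into `b`.
    induction ha using Submodule.span_induction generalizing b with
    | mem a ha =>
      obtain ⟨i, hi, rfl⟩ := ha
      rw [← star_smul_single hX]
      exact Submodule.smul_mem_smul (mem_initIdeal_of_lt _ hi) (single_mem_submodule _ hb)
    | zero => rw [zero_mul, PolynomialModule.single_zero]; exact zero_mem _
    | add a a' _ _ ha ha' =>
      rw [add_mul, PolynomialModule.single_add]
      exact add_mem (ha b hb) (ha' b hb)
    | smul c a _ ha =>
      rw [smul_eq_mul, mul_assoc, mul_left_comm]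
      exact ha _ (Ideal.mul_mem_left _ c hb)
  | add a _ b _ ha hb =>
    rw [PolynomialModule.single_add]
    exact add_mem ha hb

lemma mem_smul_sup_of_coeff_mem {l : ℕ} (h : ∀ l' < l, ∀ n, InjAt (filtG I₁ I₂).N X l' n)
    {f : PolynomialModule R R} (hf : f ∈ (filtG I₁ I₂).submodule)
    (hf' : ∀ n, f.coeff n ∈ (filtG I₁ I₂).N (n + 1) ⊔ initIdeal X l) :
    f ∈ initIdeal (star hX) l • (filtG I₁ I₂).submodule ⊔ (filtGShift I₁ I₂).submodule := by
  rw [← f.ofCoeff_coeff, ← f.coeff.sum_single, PolynomialModule.ofCoeff_finsuppSum]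
  refine sum_mem fun n _ => ?_
  obtain ⟨u, hu, s, hs, hus⟩ := Submodule.mem_sup.1 (hf' n)
  change PolynomialModule.single R n (f.coeff n) ∈ _
  rw [← hus, PolynomialModule.single_add]
  have hs' : s ∈ (filtG I₁ I₂).N n := by
    rw [show s = (u + s) - u by ring, hus]
    exact sub_mem (hf n) ((filtG I₁ I₂).mono n hu)
  refine add_mem (Submodule.mem_sup_right (single_mem_submodule (filtGShift I₁ I₂) hu)) ?_
  cases n with
  -- In degree 0 no multiple of x_i t is available, but (x_1, …, x_l) already lies in F_1.
  | zero =>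
    refine Submodule.mem_sup_right (single_mem_submodule (filtGShift I₁ I₂) ?_)
    have hle : initIdeal X l ≤ (filtG I₁ I₂).N 1 := by
      refine Ideal.span_le.2 ?_
      rintro _ ⟨i, _, rfl⟩
      simpa using mul_mem_filtG (hX i) 0 1 trivial
    exact hle hs
  | succ n =>
    exact Submodule.mem_sup_left (single_mem_smul hX l n
      (inf_initIdeal_le (fun i => mul_mem_filtG (hX i)) h n ⟨hs', hs⟩))

/-- Under the Valabrega–Valla condition G/(x_1*, …, x_l*)G is the associated graded module of
R/(x_1, …, x_l), so membership is tested degree by degree. -/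
lemma mk_mem_smul_top_iff {l : ℕ} (h : ∀ l' < l, ∀ n, InjAt (filtG I₁ I₂).N X l' n)
    (f : (filtG I₁ I₂).submodule) :
    SubQuot.mk (filtGShift I₁ I₂).submodule f ∈
        (initIdeal (star hX) l • ⊤ :
          Submodule (reesAlgebra (I₁ ⊓ I₂)) (GMod I₁ I₂)) ↔
      ∀ n, f.1.coeff n ∈ (filtG I₁ I₂).N (n + 1) ⊔ initIdeal X l := by
  rw [SubQuot.mk_mem_smul_top_iff]
  exact ⟨coeff_mem_of_mem_smul_sup hX l, mem_smul_sup_of_coeff_mem hX h f.2⟩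

lemma ofList_map_range {A : Type*} [CommRing A] (Y : ℕ → A) (l : ℕ) :
    Ideal.ofList ((List.range l).map Y) = initIdeal Y l := by
  unfold Ideal.ofList initIdeal
  congr 1
  ext a
  simp

lemma isWeaklyRegular_star {m : ℕ} (h : ∀ l < m, ∀ n, InjAt (filtG I₁ I₂).N X l n) :
    RingTheory.Sequence.IsWeaklyRegular (GMod I₁ I₂) ((List.range m).map (star hX)) := by
  refine ⟨fun l hl => ?_⟩
  have hlm : l < m := by simpa using hl
  rw [← List.map_take, List.take_range, min_eq_left hlm.le, ofList_map_range, List.getElem_map,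
    List.getElem_range, isSMulRegular_quotient_iff_mem_of_smul_mem]
  intro q hq
  obtain ⟨f, rfl⟩ := SubQuot.mk_surjective _ _ q
  have h' : ∀ l' < l, ∀ n, InjAt (filtG I₁ I₂).N X l' n := fun l' hl' => h l' (hl'.trans hlm)
  rw [mk_mem_smul_top_iff hX h']
  have hq' := (mk_mem_smul_top_iff hX h'
    ⟨star hX l • f.1, Submodule.smul_mem _ _ f.2⟩).1 hq
  intro n
  -- The degree n part of G is taken modulo F_{n+1}, so injectivity is used at n+1.
  refine h l hlm _ _ ?_
  rw [← star_smul_coeff_succ hX]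
  exact hq' (n + 1)

lemma isRegular_star (hI₁ : I₁ ≠ ⊤) {m : ℕ} (h : ∀ l < m, ∀ n, InjAt (filtG I₁ I₂).N X l n) :
    RingTheory.Sequence.IsRegular (GMod I₁ I₂) ((List.range m).map (star hX)) := by
  refine ⟨isWeaklyRegular_star hX h, fun htop => hI₁ ?_⟩
  rw [ofList_map_range] at htop
  -- Properness is visible in degree 0, where the class of 1 would force 1 ∈ I₁.
  have h₁ : SubQuot.mk (filtGShift I₁ I₂).submodule
      ⟨PolynomialModule.single R 0 1, single_mem_submodule (filtG I₁ I₂) trivial⟩ ∈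
        (initIdeal (star hX) m • ⊤ :
          Submodule (reesAlgebra (I₁ ⊓ I₂)) (GMod I₁ I₂)) := by
    rw [← htop]; trivial
  have h₂ := (mk_mem_smul_top_iff hX h _).1 h₁ 0
  rw [PolynomialModule.coeff_single, Finsupp.single_eq_same] at h₂
  rw [Ideal.eq_top_iff_one]
  have hle : (filtG I₁ I₂).N 1 ⊔ initIdeal X m ≤ I₁ := by
    refine sup_le Ideal.mul_le_left (Ideal.span_le.2 ?_)
    rintro _ ⟨i, _, rfl⟩
    exact (hX i).1
  exact hle h₂

lemma injAt_of_lt_length {J : Ideal (reesAlgebra (I₁ ⊓ I₂))}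
    (hJ : J ≤ Ideal.span (Set.range (star hX))) {ys : List (reesAlgebra (I₁ ⊓ I₂))}
    (hys : RingTheory.Sequence.IsWeaklyRegular (GMod I₁ I₂) ys) (hysJ : ∀ y ∈ ys, y ∈ J)
    {k : ℕ} (hev : ∀ l < k, ∃ N, ∀ n ≥ N, InjAt (filtG I₁ I₂).N X l n) :
    ∀ l < k, l < ys.length → ∀ n, InjAt (filtG I₁ I₂).N X l n := by
  intro l
  induction l using Nat.strong_induction_on with
  | _ l ih =>
    intro hlk hl
    have h : ∀ l' < l, ∀ n, InjAt (filtG I₁ I₂).N X l' n := fun l' hl' =>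
      ih l' hl' (hl'.trans hlk) (hl'.trans hl)
    by_contra hnot
    -- The element obtained is nonzero in G/(x_1*, …, x_l*)G and killed by J, against the existence
    -- of `ys` with more than l terms.
    obtain ⟨n, r, hr, hr', hkill⟩ := exists_socle_of_not_injAt filtG_zero (filtG I₁ I₂).mono
      (fun i => mul_mem_filtG (hX i)) (hev l hlk) hnot
    let f : (filtG I₁ I₂).submodule :=
      ⟨PolynomialModule.single R n r, single_mem_submodule (filtG I₁ I₂) hr⟩
    have hf : SubQuot.mk (filtGShift I₁ I₂).submodule f ∈
        (initIdeal (star hX) l • ⊤ :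
          Submodule (reesAlgebra (I₁ ⊓ I₂)) (GMod I₁ I₂)) := by
      rw [← ofList_map_range]
      refine mem_smul_top_of_isWeaklyRegular (isWeaklyRegular_star hX h) hys hysJ (by simpa) ?_
      intro a ha
      rw [ofList_map_range]
      have ha' := hJ ha
      clear ha
      induction ha' using Submodule.span_induction with
      | mem a ha =>
        obtain ⟨i, rfl⟩ := ha
        refine (mk_mem_smul_top_iff hX h (star hX i • f)).2 fun p => ?_
        change (star hX i • PolynomialModule.single R n r).coeff p ∈ _
        rw [star_smul_single, PolynomialModule.coeff_single, Finsupp.single_apply]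
        split_ifs with hp
        · rw [← hp]; exact hkill i
        · exact zero_mem _
      | zero => rw [zero_smul]; exact zero_mem _
      | add a b _ _ ha hb => rw [add_smul]; exact add_mem ha hb
      | smul c a _ ha => rw [smul_assoc]; exact Submodule.smul_mem _ c ha
    have := (mk_mem_smul_top_iff hX h f).1 hf n
    rw [PolynomialModule.coeff_single, Finsupp.single_eq_same] at this
    exact hr' this

end Graded

/-! ### Depth through initial segments -/

section Depth

variable {k : ℕ} {x : Fin k → R} (hx : ∀ i, x i ∈ I₁ ⊓ I₂)

lemma star_mem_starIdeal {i : ℕ} (hi : i < k) :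
    star (extendSeq_mem hx) i ∈ starIdeal hx := by
  refine Ideal.subset_span ⟨⟨i, hi⟩, Subtype.ext ?_⟩
  simp only [star, extendSeq, dif_pos hi]

lemma starIdeal_le : starIdeal hx ≤ Ideal.span (Set.range (star (extendSeq_mem hx))) := by
  refine Ideal.span_mono ?_
  rintro _ ⟨i, rfl⟩
  exact ⟨i, Subtype.ext (by simp only [star, extendSeq_of_lt])⟩

/-- The depth of `(x₁*, …, x_k*)` on the associated graded module is detected by the initial
segments of `x₁*, …, x_k*`. -/
lemma le_idealDepth_iff (hI₁ : I₁ ≠ ⊤)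
    (hev : ∀ l < k, ∃ N, ∀ n ≥ N, InjAt (filtG I₁ I₂).N (extendSeq x) l n) {m : ℕ} (hm : m ≤ k) :
    (m : ℕ∞) ≤ idealDepth (starIdeal hx) (GMod I₁ I₂) ↔
      ∀ l < m, ∀ n, InjAt (filtG I₁ I₂).N (extendSeq x) l n := by
  refine ⟨fun h l hl => ?_, fun h => ?_⟩
  · have hlt : (l : ℕ∞) < idealDepth (starIdeal hx) (GMod I₁ I₂) :=
      (Nat.cast_lt.2 hl).trans_le h
    obtain ⟨⟨ys, hys, hysJ⟩, hlen⟩ := lt_iSup_iff.1 hlt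
    exact injAt_of_lt_length (extendSeq_mem hx) (starIdeal_le hx) hys.toIsWeaklyRegular hysJ hev
      l (by omega) (Nat.cast_lt.1 hlen)
  · refine le_iSup_of_le ⟨(List.range m).map (star (extendSeq_mem hx)),
      isRegular_star (extendSeq_mem hx) hI₁ h, fun r hr => ?_⟩ (by simp)
    obtain ⟨i, hi, rfl⟩ := List.mem_map.1 hr
    exact star_mem_starIdeal hx (by rw [List.mem_range] at hi; omega)

end Depth

/-! ### Comparison with the homology of D(n) -/

section Comparison

lemma length_shortComplex_homology (S : ShortComplex (ModuleCat.{u} R)) :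
    Module.length R S.homology =
      Module.length R (SubQuot (LinearMap.ker S.g.hom) (LinearMap.range S.f.hom)) := by
  rw [S.moduleCatHomologyIso.toLinearEquiv.length_eq]
  refine LinearEquiv.length_eq (Submodule.quotEquivOfEq (LinearMap.range S.moduleCatToCycles)
    ((LinearMap.range S.f.hom).submoduleOf (LinearMap.ker S.g.hom)) ?_)
  exact Submodule.ext fun z => ⟨fun ⟨y, h⟩ => ⟨y, congrArg Subtype.val h⟩,
    fun ⟨y, h⟩ => ⟨y, Subtype.ext h⟩⟩

lemma length_subQuot_eq_of_comap {M M' : Type*} [AddCommGroup M] [Module R M] [AddCommGroup M']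
    [Module R M'] {N P : Submodule R M} {N' P' : Submodule R M'} (φ : M →ₗ[R] M')
    (hφ : Function.Surjective φ) (hN : ∀ z, z ∈ N ↔ φ z ∈ N') (hP : ∀ z, z ∈ P ↔ φ z ∈ P') :
    Module.length R (SubQuot N P) = Module.length R (SubQuot N' P') := by
  have hinj : Function.Injective
      (SubQuot.map φ (fun z => (hN z).1) (fun z => (hP z).1) : SubQuot N P →ₗ[R] SubQuot N' P') := by
    rw [← LinearMap.ker_eq_bot, SubQuot.map_eq_zero_iff_forall]
    exact fun z _ hz => (hP z).2 hz
  have hsurj : Function.Surjective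
      (SubQuot.map φ (fun z => (hN z).1) (fun z => (hP z).1) : SubQuot N P →ₗ[R] SubQuot N' P') := by
    intro q
    obtain ⟨w, rfl⟩ := SubQuot.mk_surjective _ _ q
    obtain ⟨z, hz⟩ := hφ w
    refine ⟨SubQuot.mk P ⟨z, (hN z).2 (by rw [hz]; exact w.2)⟩, ?_⟩
    rw [SubQuot.map_mk]
    congr 1
    exact Subtype.ext hz
  exact (LinearEquiv.ofBijective _ ⟨hinj, hsurj⟩).length_eq

variable {k : ℕ} {x : Fin k → R} (hx : ∀ i, x i ∈ I₁ ⊓ I₂)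

/-- D(n) sits at filtration index n+1; for j > n truncated subtraction gives F_0 = R, which is the
cut-off. -/
lemma dIdeal_eq (n j : ℕ) : dIdeal I₁ I₂ n j = (filtG I₁ I₂).N (n + 1 - j) := by
  unfold dIdeal
  split_ifs with h
  · rw [show n + 1 - j = n - j + 1 by omega]; rfl
  · rw [show n + 1 - j = 0 by omega]; rfl

/-- Restriction of functions on finite sets to the basis of the truncated Koszul complex. -/
def toDTerm (I₁ I₂ : Ideal R) (k n j : ℕ) : (Finset ℕ → R) →ₗ[R] DTerm I₁ I₂ k n j :=
  LinearMap.pi fun t => (dIdeal I₁ I₂ n j).mkQ ∘ₗ LinearMap.proj (t.1.map Fin.valEmbedding)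

lemma toDTerm_apply (n j : ℕ) (f : Finset ℕ → R) (t : KIdx k j) :
    toDTerm I₁ I₂ k n j f t = Submodule.Quotient.mk (f (t.1.map Fin.valEmbedding)) := rfl

lemma map_subset_range (t : Finset (Fin k)) : t.map Fin.valEmbedding ⊆ Finset.range k := by
  intro i hi
  obtain ⟨a, _, rfl⟩ := Finset.mem_map.1 hi
  exact Finset.mem_range.2 a.2

lemma exists_kIdx {s : Finset ℕ} {j : ℕ} (hs : s ⊆ Finset.range k) (hj : s.card = j) :
    ∃ t : KIdx k j, t.1.map Fin.valEmbedding = s :=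
  ⟨⟨s.attachFin fun m hm => Finset.mem_range.1 (hs hm), by rw [Finset.card_attachFin, hj]⟩,
    Finset.map_valEmbedding_attachFin _⟩

lemma toDTerm_surjective (n j : ℕ) : Function.Surjective (toDTerm I₁ I₂ k n j) := by
  classical
  intro w
  choose v hv using fun t => Submodule.Quotient.mk_surjective _ (w t)
  refine ⟨fun s => if h : ∃ t : KIdx k j, t.1.map Fin.valEmbedding = s then v h.choose else 0,
    funext fun t => ?_⟩
  have h : ∃ t' : KIdx k j, t'.1.map Fin.valEmbedding = t.1.map Fin.valEmbedding := ⟨t, rfl⟩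
  rw [toDTerm_apply, dif_pos h, hv]
  congr 1
  exact Subtype.ext (Finset.map_injective _ h.choose_spec)

lemma toDTerm_eq_zero_iff (n j : ℕ) (f : Finset ℕ → R) :
    toDTerm I₁ I₂ k n j f = 0 ↔
      ∀ s ⊆ Finset.range k, s.card = j → f s ∈ (filtG I₁ I₂).N (n + 1 - j) := by
  rw [funext_iff, ← dIdeal_eq]
  refine ⟨fun h s hs hj => ?_, fun h t => ?_⟩
  · obtain ⟨t, rfl⟩ := exists_kIdx hs hj
    exact (Submodule.Quotient.mk_eq_zero _).1 (h t)
  · exact (Submodule.Quotient.mk_eq_zero _).2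
      (h _ (map_subset_range _) (by rw [Finset.card_map, t.2]))

lemma toDTerm_kDiff (n j : ℕ) (f : Finset ℕ → R) :
    toDTerm I₁ I₂ k n j (kDiff (extendSeq x) k f) =
      dDiff hx n j (toDTerm I₁ I₂ k n (j + 1) f) := by
  funext t
  rw [toDTerm_apply, kDiff_apply, dDiff, LinearMap.pi_apply, LinearMap.sum_apply,
    ← Submodule.mkQ_apply, map_sum]
  symm
  refine Finset.sum_bij (fun i _ => (i.1 : ℕ)) (fun i _ => ?_)
    (fun i _ i' _ h => Subtype.ext (Fin.ext h)) (fun i hi => ?_) fun i _ => ?_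
  · rw [Finset.mem_sdiff, Finset.mem_range]
    refine ⟨i.1.2, fun h => i.2 ?_⟩
    obtain ⟨a, ha, hai⟩ := Finset.mem_map.1 h
    rwa [← Fin.ext hai]
  · rw [Finset.mem_sdiff, Finset.mem_range] at hi
    exact ⟨⟨⟨i, hi.1⟩, fun h => hi.2 (Finset.mem_map.2 ⟨_, h, rfl⟩)⟩, Finset.mem_univ _, rfl⟩
  · have hcard : ((t.1.map Fin.valEmbedding).filter (· < (i.1 : ℕ))).card =
        (t.1.filter (· < i.1)).card := by
      rw [Finset.filter_map, Finset.card_map]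
      rfl
    rw [LinearMap.smul_apply, LinearMap.comp_apply, LinearMap.proj_apply, toDTerm_apply, mulMap,
      Submodule.mapQ_apply, LinearMap.mulLeft_apply, hcard, extendSeq_of_lt, kSign, mul_assoc]
    have hins : (t.insert i).1.map Fin.valEmbedding =
        insert (i.1 : ℕ) (t.1.map Fin.valEmbedding) := Finset.map_insert _ _ _
    rw [hins, ← Submodule.Quotient.mk_smul, zsmul_eq_mul, Submodule.mkQ_apply]
    push_cast
    rfl

lemma length_kHom_eq (n j : ℕ) :
    Module.length R (KHom (filtG I₁ I₂).N (extendSeq x) k (j + 1) (n + 1)) =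
      Module.length R
        (SubQuot (LinearMap.ker (dDiff hx n j)) (LinearMap.range (dDiff hx n (j + 1)))) := by
  refine length_subQuot_eq_of_comap (toDTerm I₁ I₂ k n (j + 1)) (toDTerm_surjective n (j + 1))
    (fun f => ?_) fun f => ?_
  · rw [LinearMap.mem_ker, ← toDTerm_kDiff, toDTerm_eq_zero_iff, mem_kCycles]
    refine forall₂_congr fun s _ => ?_
    rw [add_left_inj]
    exact forall_congr' fun h => by rw [h]
  · rw [mem_kBoundaries, LinearMap.mem_range, (toDTerm_surjective n (j + 1 + 1)).exists]
    refine exists_congr fun g => ?_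
    rw [← toDTerm_kDiff, eq_comm, ← sub_eq_zero, ← map_sub, toDTerm_eq_zero_iff]
    rfl

lemma length_homology_complexD (n j : ℕ) :
    Module.length R ((complexD hx n).homology (j + 1)) =
      Module.length R (KHom (filtG I₁ I₂).N (extendSeq x) k (j + 1) (n + 1)) := by
  rw [((complexD hx n).homologyIsoSc' (j + 2) (j + 1) j (by simp)
    (by simp)).toLinearEquiv.length_eq, length_shortComplex_homology, length_kHom_eq hx]
  have hf : ((complexD hx n).sc' (j + 2) (j + 1) j).f = ModuleCat.ofHom (dDiff hx n (j + 1)) :=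
    ChainComplex.of_d (fun j => ModuleCat.of R (DTerm I₁ I₂ k n j))
      (fun j => ModuleCat.ofHom (dDiff hx n j)) _
  have hg : ((complexD hx n).sc' (j + 2) (j + 1) j).g = ModuleCat.ofHom (dDiff hx n j) :=
    ChainComplex.of_d (fun j => ModuleCat.of R (DTerm I₁ I₂ k n j))
      (fun j => ModuleCat.ofHom (dDiff hx n j)) _
  rw [hf, hg]
  rfl

end Comparison

/-! ### Finite length of R/F_n -/

section FiniteLength

variable [IsLocalRing R] [IsNoetherianRing R]

/-- A power of the maximal ideal lies in J, so R/J, if nonzero, is an Artinian local ring. -/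
lemma length_quotient_ne_top {J : Ideal R} (hJ : IsLocalRing.maximalIdeal R ≤ J.radical) :
    Module.length R (R ⧸ J) ≠ ⊤ := by
  by_cases htop : J = ⊤
  · have : Subsingleton (R ⧸ J) := Ideal.Quotient.subsingleton_iff.2 htop
    rw [Module.length_eq_zero]
    exact ENat.zero_ne_top
  have : Nontrivial (R ⧸ J) := Ideal.Quotient.nontrivial_iff.2 htop
  have : IsLocalRing (R ⧸ J) :=
    IsLocalRing.of_surjective' (Ideal.Quotient.mk J) Ideal.Quotient.mk_surjective
  obtain ⟨N, hN⟩ := Ideal.exists_pow_le_of_le_radical_of_fg hJ (IsNoetherian.noetherian _)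
  have hmax : IsLocalRing.maximalIdeal (R ⧸ J) =
      (IsLocalRing.maximalIdeal R).map (Ideal.Quotient.mk J) := by
    refine le_antisymm (fun y hy => ?_)
      (((IsLocalRing.local_hom_TFAE (Ideal.Quotient.mk J)).out 0 2).1
        (IsLocalHom.of_surjective _ Ideal.Quotient.mk_surjective))
    obtain ⟨y, rfl⟩ := Ideal.Quotient.mk_surjective y
    refine Ideal.mem_map_of_mem _ ?_
    rw [IsLocalRing.mem_maximalIdeal, mem_nonunits_iff] at hy ⊢
    exact fun h => hy (h.map _)
  have : IsArtinianRing (R ⧸ J) := by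
    rw [isArtinianRing_iff_isNilpotent_maximalIdeal, hmax]
    refine ⟨N, ?_⟩
    rw [← Ideal.map_pow, Ideal.zero_eq_bot, Ideal.map_eq_bot_iff_le_ker, Ideal.mk_ker]
    exact hN
  rw [Module.length_eq_of_surjective (S := R) (R := R ⧸ J) Ideal.Quotient.mk_surjective]
  exact Module.length_ne_top

lemma length_quotient_filtG_ne_top
    (hI₁ : I₁.radical = IsLocalRing.maximalIdeal R)
    (hI₂ : I₂.radical = IsLocalRing.maximalIdeal R) (n : ℕ) :
    Module.length R (R ⧸ (filtG I₁ I₂).N n) ≠ ⊤ := by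
  refine length_quotient_ne_top ?_
  cases n with
  | zero => rw [filtG_zero, Ideal.radical_top]; exact le_top
  | succ n =>
    change _ ≤ (I₁ * I₂ ^ n).radical
    rw [Ideal.radical_mul, hI₁]
    refine le_inf le_rfl ?_
    rcases n with _ | n
    · rw [pow_zero, Ideal.one_eq_top, Ideal.radical_top]; exact le_top
    · rw [Ideal.radical_pow _ (Nat.succ_ne_zero n), hI₂]

end FiniteLength

end FiberCone

/-! ### The main theorem -/

theorem mainTheorem9 {R : Type*} [CommRing R] [IsLocalRing R] [IsNoetherianRing R]
    (I₁ I₂ : Ideal R)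
    (hI₁ : I₁.radical = IsLocalRing.maximalIdeal R)
    (hI₂ : I₂.radical = IsLocalRing.maximalIdeal R)
    (k : ℕ) (hk : 1 ≤ k) (x : Fin k → R)
    (hreg : RingTheory.Sequence.IsRegular R (List.ofFn x))
    (hsup : FiberCone.IsSuperficialSeq I₁ I₂ x)
    (hx : ∀ i, x i ∈ I₁ ⊓ I₂)
    (i : ℕ) (hi : 1 ≤ i) :
    (∀ j, i ≤ j → FiberCone.hD hx j ≠ ⊤ ∧ (k < j → FiberCone.hD hx j = 0)) ∧
    0 ≤ ∑ j ∈ Finset.Icc i k, (-1 : ℤ) ^ (j - i) * ((FiberCone.hD hx j).toNat : ℤ) ∧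
    (∑ j ∈ Finset.Icc i k, (-1 : ℤ) ^ (j - i) * ((FiberCone.hD hx j).toNat : ℤ) = 0 ↔
      ((k + 1 - i : ℕ) : ℕ∞) ≤
        FiberCone.idealDepth (FiberCone.starIdeal hx) (FiberCone.GMod I₁ I₂)) := by
  obtain ⟨l, rfl⟩ := Nat.exists_eq_add_of_le' hk
  obtain ⟨i, rfl⟩ := Nat.exists_eq_add_of_le' hi
  have hI₁top : I₁ ≠ ⊤ := by
    rintro rfl
    rw [Ideal.radical_top] at hI₁
    exact Ideal.IsPrime.ne_top' hI₁.symm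
  have hmul : ∀ i n, ∀ r ∈ (FiberCone.filtG I₁ I₂).N n,
      FiberCone.extendSeq x i * r ∈ (FiberCone.filtG I₁ I₂).N (n + 1) :=
    fun i => FiberCone.mul_mem_filtG (FiberCone.extendSeq_mem hx i)
  have hfin := FiberCone.length_quotient_filtG_ne_top hI₁ hI₂
  have hev : ∀ m < l + 1, ∃ N, ∀ n ≥ N,
      FiberCone.InjAt (FiberCone.filtG I₁ I₂).N (FiberCone.extendSeq x) m n := fun m hm =>
    FiberCone.exists_injAt_of_isSuperficialSeq hreg.toIsWeaklyRegular hsup hm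
  have H := FiberCone.lengthRelations FiberCone.filtG_zero hmul hfin hev
  have hinj : ∀ m n, (Module.length R (LinearMap.ker
      (FiberCone.kMul FiberCone.filtG_zero hmul m 0 n))).toNat = 0 ↔
      FiberCone.InjAt (FiberCone.filtG I₁ I₂).N (FiberCone.extendSeq x) m n := fun m n => by
    rw [← FiberCone.length_ker_kMul_zero_iff FiberCone.filtG_zero hmul, ENat.toNat_eq_zero,
      or_iff_left (ne_top_of_le_ne_top (FiberCone.length_kHom_ne_top hfin m 0 n)
        (Module.length_le_of_injective _ (Submodule.subtype_injective _)))]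
  set κ : ℕ → ℕ → ℕ → ℕ := fun m j n => (Module.length R (LinearMap.ker
      (FiberCone.kMul FiberCone.filtG_zero hmul m j n))).toNat with hκ
  have hD : ∀ j, FiberCone.hD hx (j + 1) =
      ((∑' n, κ l (j + 1) n + ∑' n, κ l j n : ℕ) : ℕ∞) := by
    intro j
    rw [← H.tsum_h (Nat.lt_succ_self l) j]
    refine tsum_congr fun n => ?_
    rw [FiberCone.length_homology_complexD,
      ENat.natCast_toNat (FiberCone.length_kHom_ne_top hfin _ _ _)]
  -- Koszul homology of l elements vanishes above degree l; this closes the telescope and gives h_j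
  -- = 0 for j > k.
  have hK : ∀ j, l < j → ∑' n, κ l j n = 0 := fun j hj => by
    rw [H.tsum_κ_eq_zero_iff (Nat.lt_succ_self l)]
    exact fun n => Nat.eq_zero_of_le_zero ((H.κ_le l j n).trans (H.h_eq_zero_of_lt hj n).le)
  refine ⟨fun j hj => ?_, ?_⟩
  · obtain ⟨j, rfl⟩ := Nat.exists_eq_add_of_le' (hi.trans hj)
    rw [hD]
    refine ⟨ENat.natCast_ne_top _, fun h => ?_⟩
    rw [hK j (by omega), hK (j + 1) (by omega)]
    rfl
  -- If the original index exceeds k, the sum is empty and the required depth is the truncated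
  -- difference 0, so both sides hold.
  · rcases lt_or_ge l i with hli | hil
    · rw [Finset.Icc_eq_empty (by omega), show l + 1 + 1 - (i + 1) = 0 by omega]
      simp
    have hsum : ∑ j ∈ Finset.Icc (i + 1) (l + 1),
        (-1 : ℤ) ^ (j - (i + 1)) * ((FiberCone.hD hx j).toNat : ℤ) =
          ((∑' n, κ l i n : ℕ) : ℤ) := by
      rw [← FiberCone.alternating_sum_telescope (fun j => ((∑' n, κ l j n : ℕ) : ℤ)) hil
        (by rw [hK _ (Nat.lt_succ_self l)]; rfl)]
      refine Finset.sum_congr rfl fun j hj => ?_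
      obtain ⟨j, rfl⟩ := Nat.exists_eq_add_of_le' (hi.trans (Finset.mem_Icc.1 hj).1)
      rw [hD, ENat.toNat_natCast, Nat.add_sub_cancel, Nat.cast_add]
    rw [hsum]
    refine ⟨Nat.cast_nonneg _, ?_⟩
    rw [Nat.cast_eq_zero, H.tsum_κ_eq_zero_iff (Nat.lt_succ_self l),
      H.κ_zero_iff_regular (Nat.lt_succ_self l), FiberCone.le_idealDepth_iff hx hI₁top hev (by omega),
      show l + 1 + 1 - (i + 1) = l + 1 - i by omega]
    simp only [hκ, hinj]
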